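/- Let $k$ be a field of characteristic $\neq 2$ and let $A=A_+\oplus A_-$ be a super-affine Hopf algebra over $k$: a finitely generated super-commutative $k$-superalgebra with a coassociative, counital comultiplication $m^*:A\to A\otimes^\varepsilon A$ ($\otimes^\varepsilon$ the super tensor product, with the sign rule), counit $e^*:A\to k$ and antipode, all three being (even) homomorphisms of $k$-superalgebras. Let $J$ be the ideal of $A$ generated by $A_-$, $\pi:A\to B=A/J$ the projection, $G=\mathrm{Spec}(B)$, and regard $A$ as a $B$-comodule via $\Delta=(\mathrm{id}\otimes\pi)\circ m^*:A\to A\otimes B$. The powers $J^n$ are subcomodules, so that $J^n/J^{n+1}$ is a $B$-module and a $B$-comodule. For a $B$-comodule $(V,\Delta_V)$ put $V^G=\{v\in V:\Delta_V(v)=v\otimes 1\}$; in particular $A^G=\{a\in A:\Delta(a)=a\otimes 1\}$ is a $k$-subalgebra of $A$. Let $\mathfrak g_-$ be the $k$-vector space of odd left-invariant $k$-superderivations of $A$, that is of odd $k$-linear maps $D:A\to A$ with $D(ab)=D(a)b+(-1)^{|a|}aD(b)$ for homogeneous $a$ and all $b$, and $m^*\circ D=(\mathrm{id}\otimes^\varepsilon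 D)\circ m^*$, where $(\mathrm{id}\otimes^\varepsilon D)(a\otimes b)=(-1)^{|a|}a\otimes D(b)$. Then $\mathfrak g_-$ is finite dimensional; put $s=\dim_k\mathfrak g_-$. There exist odd elements $\theta_1,\dots,\theta_s\in A^G\cap A_-$ whose classes form a $k$-basis of $(J/J^2)^G$, and for every such choice $A^G$ is the superpolynomial (exterior) algebra over $k$ in the odd variables $\theta_i$: there is an isomorphism of $k$-algebras $\Lambda_k(k^s)\to A^G$ that sends the $i$-th standard basis vector to $\theta_i$. Moreover, for every $n\ge 0$ the $B$-module $J^n/J^{n+1}$ is free of finite rank $\binom{s}{n}$, and $\dim_k A^G=2^s$. -/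

import Mathlib

open scoped TensorProduct

namespace SuperHopf


section Basic

variable {k A : Type*} [Field k] [Ring A] [Algebra k A]
variable (𝒜 : ZMod 2 → Submodule k A)

/-- The part of parity `i` of the super vector space `A ⊗ A`, for `A = 𝒜 0 ⊕ 𝒜 1`. -/
def tensorPart (i : ZMod 2) : Submodule k (A ⊗[k] A) :=
  ⨆ p : ZMod 2, LinearMap.range (TensorProduct.map (𝒜 p).subtype (𝒜 (i - p)).subtype)

/-- A super-affine Hopf algebra over `k`: a finitely generated super-commutative `k`-algebra
`A = 𝒜 0 ⊕ 𝒜 1` with a coalgebra structure and an antipode such that the comultiplication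
(with values in the super tensor product `𝒜 ᵍ⊗[k] 𝒜`), the counit and the antipode are
morphisms of super algebras. -/
class IsSuperAffineHopfAlgebra [GradedAlgebra 𝒜] [Coalgebra k A] : Prop where
  finiteType : Algebra.FiniteType k A
  superComm : ∀ (i j : ZMod 2) (a b : A), a ∈ 𝒜 i → b ∈ 𝒜 j →
    a * b = ((-1 : ℤˣ) ^ (i * j)) • (b * a)
  comul_mem : ∀ (i : ZMod 2) (a : A), a ∈ 𝒜 i → Coalgebra.comul (R := k) a ∈ tensorPart 𝒜 i
  comul_one : GradedTensorProduct.of k 𝒜 𝒜 (Coalgebra.comul (R := k) (1 : A)) = 1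
  comul_mul : ∀ a b : A, GradedTensorProduct.of k 𝒜 𝒜 (Coalgebra.comul (R := k) (a * b)) =
    GradedTensorProduct.of k 𝒜 𝒜 (Coalgebra.comul (R := k) a) *
      GradedTensorProduct.of k 𝒜 𝒜 (Coalgebra.comul (R := k) b)
  counit_odd : ∀ a : A, a ∈ 𝒜 1 → Coalgebra.counit (R := k) a = 0
  counit_one : Coalgebra.counit (R := k) (1 : A) = 1
  counit_mul : ∀ a b : A, Coalgebra.counit (R := k) (a * b) =
    Coalgebra.counit (R := k) a * Coalgebra.counit (R := k) b
  exists_antipode : ∃ S : A →ₐ[k] A,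
    (∀ (i : ZMod 2) (a : A), a ∈ 𝒜 i → S a ∈ 𝒜 i) ∧
    LinearMap.mul' k A ∘ₗ TensorProduct.map S.toLinearMap LinearMap.id ∘ₗ Coalgebra.comul =
      Algebra.linearMap k A ∘ₗ Coalgebra.counit ∧
    LinearMap.mul' k A ∘ₗ TensorProduct.map LinearMap.id S.toLinearMap ∘ₗ Coalgebra.comul =
      Algebra.linearMap k A ∘ₗ Coalgebra.counit

/-- The super radical: the ideal generated by the odd part. -/
def superRadical : Ideal A := Ideal.span (𝒜 1 : Set A)

end Basic

noncomputable section

variable {k A : Type*} [Field k] [Ring A] [Algebra k A] [Coalgebra k A]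
variable (𝒜 : ZMod 2 → Submodule k A) [GradedAlgebra 𝒜]

/-- The parity automorphism `a ↦ (-1)^|a| a`. -/
def parity : Module.End k A := GradedAlgebra.proj 𝒜 0 - GradedAlgebra.proj 𝒜 1

/-- The part of parity `p` of the Lie superalgebra of `A`: the `k`-superderivations `D` of
parity `p` that are left-invariant, that is `comul ∘ D = (id ⊗ D) ∘ comul`, where by the sign
rule `(id ⊗ D) (a ⊗ b) = (-1)^(p|a|) a ⊗ D b`. -/
def lieAlg (p : ZMod 2) : Submodule k (Module.End k A) where
  carrier := {D | (∀ (i : ZMod 2) (a : A), a ∈ 𝒜 i → D a ∈ 𝒜 (i + p)) ∧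
    (∀ a b : A, D (a * b) = D a * b + (parity 𝒜 ^ p.val) a * D b) ∧
    Coalgebra.comul ∘ₗ D = TensorProduct.map (parity 𝒜 ^ p.val) D ∘ₗ Coalgebra.comul}
  add_mem' := by
    rintro D E ⟨h1, h2, h3⟩ ⟨g1, g2, g3⟩
    refine ⟨fun i a ha => (𝒜 (i + p)).add_mem (h1 i a ha) (g1 i a ha), fun a b => ?_, ?_⟩
    · simp only [LinearMap.add_apply, h2, g2, add_mul, mul_add]
      abel
    · rw [LinearMap.comp_add, h3, g3, TensorProduct.map_add_right, LinearMap.add_comp]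
  zero_mem' := by
    refine ⟨fun i a _ => (𝒜 (i + p)).zero_mem, fun a b => ?_, ?_⟩
    · simp
    · simp
  smul_mem' := by
    rintro c D ⟨h1, h2, h3⟩
    refine ⟨fun i a ha => (𝒜 (i + p)).smul_mem c (h1 i a ha), fun a b => ?_, ?_⟩
    · simp only [LinearMap.smul_apply, h2, smul_add, smul_mul_assoc, mul_smul_comm]
    · rw [LinearMap.comp_smul, h3, TensorProduct.map_smul_right, LinearMap.smul_comp]

variable [IsSuperAffineHopfAlgebra 𝒜]

theorem eq_zero_or_one : ∀ j : ZMod 2, j = 0 ∨ j = 1 := by decide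

theorem even_add_odd (a : A) : ∃ b ∈ 𝒜 0, ∃ c ∈ 𝒜 1, a = b + c := by
  classical
  refine ⟨_, (DirectSum.decompose 𝒜 a 0).2, _, (DirectSum.decompose 𝒜 a 1).2, ?_⟩
  conv_lhs => rw [← DirectSum.sum_support_decompose 𝒜 a]
  rw [Finset.sum_subset (Finset.subset_univ _) (fun i _ hi => by simpa using hi)]
  exact Fin.sum_univ_two _

theorem even_comm {a : A} (ha : a ∈ 𝒜 0) (b : A) : a * b = b * a := by
  obtain ⟨b0, h0, b1, h1, rfl⟩ := even_add_odd 𝒜 b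
  have e0 := IsSuperAffineHopfAlgebra.superComm 0 0 a b0 ha h0
  have e1 := IsSuperAffineHopfAlgebra.superComm 0 1 a b1 ha h1
  rw [zero_mul, uzpow_zero, one_smul] at e0 e1
  rw [mul_add, add_mul, e0, e1]

theorem odd_mem {a : A} (ha : a ∈ 𝒜 1) : a ∈ superRadical 𝒜 := Ideal.subset_span ha

instance : (superRadical 𝒜).IsTwoSided := by
  refine ⟨fun {a} b ha => ?_⟩
  induction ha using Submodule.span_induction with
  | mem x hx =>
    obtain ⟨b0, h0, b1, h1, rfl⟩ := even_add_odd 𝒜 b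
    rw [mul_add, ← even_comm 𝒜 h0]
    refine Ideal.add_mem _ (Ideal.mul_mem_left _ _ (odd_mem 𝒜 hx))
      (Ideal.mul_mem_left _ _ (odd_mem 𝒜 h1))
  | zero => simp
  | add x y _ _ hx hy => rw [add_mul]; exact Ideal.add_mem _ hx hy
  | smul c x _ hx => rw [smul_mul_assoc]; exact Submodule.smul_mem _ c hx

/-- The coordinate ring `B = A / J` of the group scheme `G`. -/
abbrev evenQuotient : Type _ := A ⧸ superRadical 𝒜

/-- The projection `π : A → B`. -/
abbrev proj : A →ₐ[k] evenQuotient 𝒜 := Ideal.Quotient.mkₐ k (superRadical 𝒜)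

/-- The comultiplication as a homomorphism into the super tensor product. -/
def comulHom : A →ₐ[k] 𝒜 ᵍ⊗[k] 𝒜 :=
  AlgHom.ofLinearMap ((GradedTensorProduct.of k 𝒜 𝒜).toLinearMap ∘ₗ Coalgebra.comul)
    IsSuperAffineHopfAlgebra.comul_one IsSuperAffineHopfAlgebra.comul_mul

/-- The map `id ⊗ π : A ⊗ A → A ⊗ B`; since `B` is even, the super tensor product of `A` and `B`
is the usual one. -/
def idTensorProj : 𝒜 ᵍ⊗[k] 𝒜 →ₐ[k] A ⊗[k] evenQuotient 𝒜 :=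
  GradedTensorProduct.lift 𝒜 𝒜 Algebra.TensorProduct.includeLeft
    (Algebra.TensorProduct.includeRight.comp (proj 𝒜)) (by
      intro i j a b
      rcases eq_zero_or_one j with rfl | rfl
      · rw [zero_mul, uzpow_zero, one_smul]
        simp
      · have hb : proj 𝒜 (b : A) = 0 := Ideal.Quotient.eq_zero_iff_mem.2 (odd_mem 𝒜 b.2)
        have h0 : (Algebra.TensorProduct.includeRight.comp (proj 𝒜) : A →ₐ[k] A ⊗[k] _)
            (b : A) = 0 := by
          rw [AlgHom.comp_apply, hb, map_zero]
        rw [h0, mul_zero, zero_mul, smul_zero])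

theorem idTensorProj_of (x : A ⊗[k] A) :
    idTensorProj 𝒜 (GradedTensorProduct.of k 𝒜 𝒜 x) =
      LinearMap.lTensor A (proj 𝒜).toLinearMap x := by
  induction x with
  | zero => simp
  | add x y hx hy => simp only [map_add, hx, hy]
  | tmul a b =>
    refine (GradedTensorProduct.lift_tmul _ _ _ _ _ a b).trans ?_
    simp

/-- The `B`-comodule structure `Δ = (id ⊗ π) ∘ comul` of `A`. -/
def coaction : A →ₐ[k] A ⊗[k] evenQuotient 𝒜 := (idTensorProj 𝒜).comp (comulHom 𝒜)

/-- `A^G`, the subalgebra of all `a` with `Δ a = a ⊗ 1`. -/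
def invariants : Subalgebra k A :=
  AlgHom.equalizer (coaction 𝒜) Algebra.TensorProduct.includeLeft

/-- `J^n ⊗ B → A ⊗ B`. -/
def powTensor (n : ℕ) :
    ↥(superRadical 𝒜 ^ n) ⊗[k] evenQuotient 𝒜 →ₗ[k] A ⊗[k] evenQuotient 𝒜 :=
  LinearMap.rTensor _ ((superRadical 𝒜 ^ n).subtype.restrictScalars k)

theorem powTensor_injective (n : ℕ) : Function.Injective (powTensor 𝒜 n) :=
  Module.Flat.rTensor_preserves_injective_linearMap _ Subtype.val_injective

theorem tmul_mem_range (I : Ideal A) {a : A} (ha : a ∈ I) (b : evenQuotient 𝒜) :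
    a ⊗ₜ[k] b ∈ LinearMap.range
      (LinearMap.rTensor (evenQuotient 𝒜) (I.subtype.restrictScalars k)) :=
  ⟨(⟨a, ha⟩ : I) ⊗ₜ[k] b, rfl⟩

theorem mul_mem_range (I I' I'' : Ideal A) (h : ∀ a ∈ I, ∀ b ∈ I', a * b ∈ I'')
    {x y : A ⊗[k] evenQuotient 𝒜}
    (hx : x ∈ LinearMap.range
      (LinearMap.rTensor (evenQuotient 𝒜) (I.subtype.restrictScalars k)))
    (hy : y ∈ LinearMap.range
      (LinearMap.rTensor (evenQuotient 𝒜) (I'.subtype.restrictScalars k))) :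
    x * y ∈ LinearMap.range
      (LinearMap.rTensor (evenQuotient 𝒜) (I''.subtype.restrictScalars k)) := by
  obtain ⟨x, rfl⟩ := hx
  obtain ⟨y, rfl⟩ := hy
  induction x with
  | zero => simp
  | add x x' hx hx' => rw [map_add, add_mul]; exact Submodule.add_mem _ hx hx'
  | tmul a b =>
    induction y with
    | zero => simp
    | add y y' hy hy' => rw [map_add, mul_add]; exact Submodule.add_mem _ hy hy'
    | tmul c d =>
      rw [LinearMap.rTensor_tmul, LinearMap.rTensor_tmul, Algebra.TensorProduct.tmul_mul_tmul]
      exact tmul_mem_range 𝒜 I'' (h _ a.2 _ c.2) _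

theorem mem_range_top (I : Ideal A) (hI : ∀ a, a ∈ I) (x : A ⊗[k] evenQuotient 𝒜) :
    x ∈ LinearMap.range
      (LinearMap.rTensor (evenQuotient 𝒜) (I.subtype.restrictScalars k)) := by
  induction x with
  | zero => simp
  | add x y hx hy => exact Submodule.add_mem _ hx hy
  | tmul a b => exact tmul_mem_range 𝒜 I (hI a) b

theorem coaction_odd_mem {x : A} (hx : x ∈ 𝒜 1) :
    coaction 𝒜 x ∈ LinearMap.range
      (LinearMap.rTensor (evenQuotient 𝒜) ((superRadical 𝒜).subtype.restrictScalars k)) := by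
  have h := IsSuperAffineHopfAlgebra.comul_mem (𝒜 := 𝒜) 1 x hx
  have e : coaction 𝒜 x = LinearMap.lTensor A (proj 𝒜).toLinearMap (Coalgebra.comul x) :=
    idTensorProj_of 𝒜 _
  rw [e]
  suffices H : tensorPart 𝒜 1 ≤ (LinearMap.range (LinearMap.rTensor (evenQuotient 𝒜)
      ((superRadical 𝒜).subtype.restrictScalars k))).comap
        (LinearMap.lTensor A (proj 𝒜).toLinearMap) from H h
  refine iSup_le fun p => ?_
  rintro _ ⟨t, rfl⟩
  induction t with
  | zero => simp
  | add t u ht hu => rw [map_add]; exact Submodule.add_mem _ ht hu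
  | tmul a b =>
    rw [TensorProduct.map_tmul, Submodule.mem_comap, LinearMap.lTensor_tmul]
    rcases eq_zero_or_one p with rfl | rfl
    · have hb : (proj 𝒜).toLinearMap ((𝒜 (1 - 0)).subtype b) = 0 :=
        Ideal.Quotient.eq_zero_iff_mem.2 (odd_mem 𝒜 (by simpa using b.2))
      rw [hb, TensorProduct.tmul_zero]
      exact Submodule.zero_mem _
    · exact tmul_mem_range 𝒜 _ (odd_mem 𝒜 a.2) _

theorem coaction_rad_mem {x : A} (hx : x ∈ superRadical 𝒜) :
    coaction 𝒜 x ∈ LinearMap.range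
      (LinearMap.rTensor (evenQuotient 𝒜) ((superRadical 𝒜).subtype.restrictScalars k)) := by
  induction hx using Submodule.span_induction with
  | mem x hx => exact coaction_odd_mem 𝒜 hx
  | zero => rw [map_zero]; exact Submodule.zero_mem _
  | add x y _ _ hx hy => rw [map_add]; exact Submodule.add_mem _ hx hy
  | smul c x _ hx =>
    rw [smul_eq_mul, map_mul]
    exact mul_mem_range 𝒜 ⊤ _ _ (fun a _ b hb => Ideal.mul_mem_left _ a hb)
      (mem_range_top 𝒜 ⊤ (fun _ => trivial) _) hx

theorem coaction_mem (n : ℕ) {x : A} (hx : x ∈ superRadical 𝒜 ^ n) :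
    coaction 𝒜 x ∈ LinearMap.range (powTensor 𝒜 n) := by
  induction n generalizing x with
  | zero =>
    refine mem_range_top 𝒜 _ (fun a => ?_) _
    rw [Submodule.pow_zero, Ideal.one_eq_top]
    trivial
  | succ n ih =>
    rw [Ideal.IsTwoSided.pow_succ] at hx
    induction hx using Submodule.smul_induction_on' with
    | smul r hr y hy =>
      rw [smul_eq_mul, map_mul]
      refine mul_mem_range 𝒜 _ _ _ (fun a ha b hb => ?_) (coaction_rad_mem 𝒜 hr) (ih hy)
      rw [Ideal.IsTwoSided.pow_succ]
      exact Ideal.mul_mem_mul ha hb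
    | add x _ y _ hx hy => rw [map_add]; exact Submodule.add_mem _ hx hy

/-- The `B`-comodule structure of `J^n`. -/
def powCoaction (n : ℕ) :
    ↥(superRadical 𝒜 ^ n) →ₗ[k] ↥(superRadical 𝒜 ^ n) ⊗[k] evenQuotient 𝒜 :=
  (LinearEquiv.ofInjective (powTensor 𝒜 n) (powTensor_injective 𝒜 n)).symm.toLinearMap ∘ₗ
    LinearMap.codRestrict (LinearMap.range (powTensor 𝒜 n))
      ((coaction 𝒜).toLinearMap ∘ₗ (superRadical 𝒜 ^ n).subtype.restrictScalars k)
      (fun x => coaction_mem 𝒜 n x.2)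

theorem powTensor_powCoaction (n : ℕ) (x : ↥(superRadical 𝒜 ^ n)) :
    powTensor 𝒜 n (powCoaction 𝒜 n x) = coaction 𝒜 (x : A) :=
  congrArg Subtype.val ((LinearEquiv.ofInjective (powTensor 𝒜 n)
    (powTensor_injective 𝒜 n)).apply_symm_apply _)

/-- The quotient `J^n / J^(n+1)`. -/
abbrev gr (n : ℕ) : Type _ :=
  ↥(superRadical 𝒜 ^ n) ⧸ (superRadical 𝒜 ^ (n + 1)).submoduleOf (superRadical 𝒜 ^ n)

/-- The projection `J^n → J^n / J^(n+1)`. -/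
abbrev grMk (n : ℕ) : ↥(superRadical 𝒜 ^ n) →ₗ[A] gr 𝒜 n := Submodule.mkQ _

theorem gr_torsion (n : ℕ) :
    Module.IsTorsionBySet A (gr 𝒜 n) (superRadical 𝒜 : Set A) := by
  intro x a
  induction x using Submodule.Quotient.induction_on with
  | _ x =>
  refine (Submodule.Quotient.mk_eq_zero _).2 ?_
  change (a : A) * (x : A) ∈ superRadical 𝒜 ^ (n + 1)
  rw [Ideal.IsTwoSided.pow_succ]
  exact Ideal.mul_mem_mul a.2 x.2

/-- The `B`-module structure of `J^n / J^(n+1)`, induced by multiplication in `A`. -/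
instance (n : ℕ) : Module (evenQuotient 𝒜) (gr 𝒜 n) := (gr_torsion 𝒜 n).module

theorem grCoaction_aux (n : ℕ) (x : ↥(superRadical 𝒜 ^ n))
    (hx : (x : A) ∈ superRadical 𝒜 ^ (n + 1)) :
    LinearMap.rTensor (evenQuotient 𝒜) ((grMk 𝒜 n).restrictScalars k) (powCoaction 𝒜 n x) = 0 := by
  have hle : superRadical 𝒜 ^ (n + 1) ≤ superRadical 𝒜 ^ n := Ideal.pow_le_pow_right n.le_succ
  let j : ↥(superRadical 𝒜 ^ (n + 1)) →ₗ[k] ↥(superRadical 𝒜 ^ n) :=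
    (Submodule.inclusion hle).restrictScalars k
  have e : powCoaction 𝒜 n x =
      LinearMap.rTensor (evenQuotient 𝒜) j (powCoaction 𝒜 (n + 1) ⟨x, hx⟩) := by
    apply powTensor_injective 𝒜 n
    rw [powTensor_powCoaction, powTensor, ← LinearMap.comp_apply, ← LinearMap.rTensor_comp]
    exact (powTensor_powCoaction 𝒜 (n + 1) ⟨x, hx⟩).symm
  have z : (grMk 𝒜 n).restrictScalars k ∘ₗ j = 0 := by
    ext y
    exact (Submodule.Quotient.mk_eq_zero _).2 y.2
  rw [e, ← LinearMap.comp_apply, ← LinearMap.rTensor_comp, z, LinearMap.rTensor_zero,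
    LinearMap.zero_apply]

/-- The `B`-comodule structure of `J^n / J^(n+1)` as a quotient of `J^n`. -/
def grCoaction (n : ℕ) : gr 𝒜 n →ₗ[k] gr 𝒜 n ⊗[k] evenQuotient 𝒜 :=
  (((superRadical 𝒜 ^ (n + 1)).submoduleOf (superRadical 𝒜 ^ n)).restrictScalars k).liftQ
    (LinearMap.rTensor _ ((grMk 𝒜 n).restrictScalars k) ∘ₗ powCoaction 𝒜 n) (fun x hx => grCoaction_aux 𝒜 n x hx) ∘ₗ
  (Submodule.Quotient.restrictScalarsEquiv k _).symm.toLinearMap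

/-- The invariants `(J^n / J^(n+1))^G`. -/
def grInvariants (n : ℕ) : Submodule k (gr 𝒜 n) :=
  LinearMap.eqLocus (grCoaction 𝒜 n)
    ((TensorProduct.mk k (gr 𝒜 n) (evenQuotient 𝒜)).flip 1)

theorem odd_mem_pow_one {a : A} (ha : a ∈ 𝒜 1) : a ∈ superRadical 𝒜 ^ 1 := by
  rw [Submodule.pow_one]
  exact odd_mem 𝒜 ha

/-- The family `θ` consists of odd `G`-invariant elements (of `J`) representing a `k`-basis of
`(J / J^2)^G`. -/
structure IsOddCoordinates {s : ℕ} (θ : Fin s → A) : Prop where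
  odd : ∀ i, θ i ∈ 𝒜 1
  invariant : ∀ i, θ i ∈ invariants 𝒜
  linearIndependent : LinearIndependent k fun i => grMk 𝒜 1 ⟨θ i, odd_mem_pow_one 𝒜 (odd i)⟩
  span_eq : Submodule.span k (Set.range fun i => grMk 𝒜 1 ⟨θ i, odd_mem_pow_one 𝒜 (odd i)⟩) =
    grInvariants 𝒜 1



end

end SuperHopf

/-!
Write `B = A / J`, a commutative Hopf algebra. Each `J^n / J^(n+1)` is a Hopf module over `B`, so
it is free on any `k`-basis of its invariants, and the first cohomology of its cobar complex
vanishes. As `J` is nilpotent, that vanishing passes to `J^2`, and therefore invariants of `J / J^2`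
lift to `A`; since every class in `J / J^2` has an odd representative, the lifts can be taken odd.
This gives `θ`, and by Nakayama's lemma the `θ i` generate `J`.

An odd left-invariant superderivation is determined by its composite with the counit, an odd point
derivation, and such point derivations are the linear forms on `(J / J^2)^G`. Hence there are
left-invariant odd superderivations `D i` which at the counit are dual to `θ`. Applying the `D i`
one after the other to a product of `r` distinct `θ i` shows that it is not in the `(r+1)`-st power
of the kernel of the counit. Multiplying a linear relation by the monomial complementary to one of
its terms then shows that the monomials are independent, even modulo powers of `J`. So those of
degree `n` form a `B`-basis of `J^n / J^(n+1)`, and, by descent along the powers of `J`, all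
monomials together form a `k`-basis of `A^G`.
-/

namespace SuperHopf

noncomputable section

section Comodule

open Coalgebra TensorProduct LinearMap

variable {k C M N : Type*} [CommRing k] [AddCommGroup C] [Module k C]
  [AddCommGroup M] [Module k M] [AddCommGroup N] [Module k N]

/-- The linear map `f` commutes with the coactions `ρ` and `ρ'`. -/
def IsComoduleHom (ρ : M →ₗ[k] M ⊗[k] C) (ρ' : N →ₗ[k] N ⊗[k] C) (f : M →ₗ[k] N) : Prop :=
  f.rTensor C ∘ₗ ρ = ρ' ∘ₗ f

variable {ρ : M →ₗ[k] M ⊗[k] C} {ρ' : N →ₗ[k] N ⊗[k] C} {f : M →ₗ[k] N}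

theorem IsComoduleHom.apply (hf : IsComoduleHom ρ ρ' f) (m : M) :
    f.rTensor C (ρ m) = ρ' (f m) :=
  LinearMap.congr_fun hf m

theorem IsComoduleHom.assoc_rTensor_comp (hf : IsComoduleHom ρ ρ' f) :
    (TensorProduct.assoc k N C C).toLinearMap ∘ₗ ρ'.rTensor C ∘ₗ f.rTensor C =
      f.rTensor (C ⊗[k] C) ∘ₗ (TensorProduct.assoc k M C C).toLinearMap ∘ₗ ρ.rTensor C := by
  rw [← rTensor_comp, ← hf, rTensor_comp]
  simp only [← LinearMap.comp_assoc]
  congr 1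
  ext
  rfl

variable [Coalgebra k C]

/-- `ρ` makes the `k`-module `M` into a right comodule over the coalgebra `C`. -/
structure IsComodule (ρ : M →ₗ[k] M ⊗[k] C) : Prop where
  coassoc : (TensorProduct.assoc k M C C).toLinearMap ∘ₗ ρ.rTensor C ∘ₗ ρ = comul.lTensor M ∘ₗ ρ
  counit : counit.lTensor M ∘ₗ ρ = (TensorProduct.mk k M k).flip 1

namespace IsComodule

theorem of_coalgHom {Q : Type*} [AddCommGroup Q] [Module k Q] [Coalgebra k Q] (p : C →ₗc[k] Q) :
    IsComodule (p.toLinearMap.lTensor C ∘ₗ comul) where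
  coassoc := by
    have hassoc : (TensorProduct.assoc k C Q Q).toLinearMap ∘ₗ
        (p.toLinearMap.lTensor C ∘ₗ comul).rTensor Q ∘ₗ p.toLinearMap.lTensor C =
          (TensorProduct.map p.toLinearMap p.toLinearMap).lTensor C ∘ₗ
            (TensorProduct.assoc k C C C).toLinearMap ∘ₗ comul.rTensor C := by
      rw [rTensor_comp, LinearMap.comp_assoc, rTensor_comp_lTensor, ← lTensor_comp_rTensor]
      simp only [← LinearMap.comp_assoc]
      congr 1
      ext
      rfl
    have hcomul : comul.lTensor C ∘ₗ p.toLinearMap.lTensor C =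
        (TensorProduct.map p.toLinearMap p.toLinearMap).lTensor C ∘ₗ comul.lTensor C := by
      rw [← lTensor_comp, ← lTensor_comp, p.map_comp_comul]
    rw [← LinearMap.comp_assoc comul _ (comul.lTensor C), hcomul, LinearMap.comp_assoc,
      ← Coalgebra.coassoc, ← LinearMap.comp_assoc comul, ← LinearMap.comp_assoc, hassoc]
    rfl
  counit := by
    rw [← LinearMap.comp_assoc, ← lTensor_comp, p.counit_comp, lTensor_counit_comp_comul]

theorem of_injective [Module.Flat k C] (h : IsComodule ρ') (hf : IsComoduleHom ρ ρ' f)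
    (hinj : Function.Injective f) : IsComodule ρ where
  coassoc := by
    rw [← cancel_left (Module.Flat.rTensor_preserves_injective_linearMap (M := C ⊗[k] C) f hinj)]
    calc f.rTensor (C ⊗[k] C) ∘ₗ (TensorProduct.assoc k M C C).toLinearMap ∘ₗ ρ.rTensor C ∘ₗ ρ
        = (TensorProduct.assoc k N C C).toLinearMap ∘ₗ ρ'.rTensor C ∘ₗ f.rTensor C ∘ₗ ρ :=
          congr($hf.assoc_rTensor_comp.symm ∘ₗ ρ)
      _ = comul.lTensor N ∘ₗ f.rTensor C ∘ₗ ρ := by rw [hf]; exact congr($h.coassoc ∘ₗ f)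
      _ = f.rTensor (C ⊗[k] C) ∘ₗ comul.lTensor M ∘ₗ ρ := by
          rw [← LinearMap.comp_assoc, lTensor_comp_rTensor, ← rTensor_comp_lTensor,
            LinearMap.comp_assoc]
  counit := by
    rw [← cancel_left (Module.Flat.rTensor_preserves_injective_linearMap (M := k) f hinj),
      ← LinearMap.comp_assoc, rTensor_comp_lTensor, ← lTensor_comp_rTensor,
      LinearMap.comp_assoc, hf, ← LinearMap.comp_assoc, h.counit]
    rfl

theorem of_surjective (h : IsComodule ρ) (hf : IsComoduleHom ρ ρ' f)
    (hsurj : Function.Surjective f) : IsComodule ρ' where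
  coassoc := by
    rw [← cancel_right hsurj]
    calc (TensorProduct.assoc k N C C).toLinearMap ∘ₗ ρ'.rTensor C ∘ₗ ρ' ∘ₗ f
        = f.rTensor (C ⊗[k] C) ∘ₗ
            (TensorProduct.assoc k M C C).toLinearMap ∘ₗ ρ.rTensor C ∘ₗ ρ := by
          rw [← hf]; exact congr($hf.assoc_rTensor_comp ∘ₗ ρ)
      _ = comul.lTensor N ∘ₗ f.rTensor C ∘ₗ ρ := by
          rw [h.coassoc, ← LinearMap.comp_assoc, rTensor_comp_lTensor, ← lTensor_comp_rTensor,
            LinearMap.comp_assoc]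
      _ = comul.lTensor N ∘ₗ ρ' ∘ₗ f := by rw [hf]
  counit := by
    rw [← cancel_right hsurj, LinearMap.comp_assoc, ← hf, ← LinearMap.comp_assoc,
      lTensor_comp_rTensor, ← rTensor_comp_lTensor, LinearMap.comp_assoc, h.counit]
    rfl

end IsComodule

end Comodule

section Cobar

open Coalgebra TensorProduct LinearMap

variable {k B L M N : Type*} [CommRing k] [Ring B] [Bialgebra k B] [AddCommGroup L] [Module k L]
  [AddCommGroup M] [Module k M] [AddCommGroup N] [Module k N]

/-- The coinvariants `{m | ρ m = m ⊗ 1}` of a coaction. -/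
def coinvariants (ρ : M →ₗ[k] M ⊗[k] B) : Submodule k M :=
  eqLocus ρ ((TensorProduct.mk k M B).flip 1)

/-- The differential `m ↦ ρ m - m ⊗ 1` of the cobar complex in degree zero. -/
def cobarZero (ρ : M →ₗ[k] M ⊗[k] B) : M →ₗ[k] M ⊗[k] B :=
  ρ - (TensorProduct.mk k M B).flip 1

/-- The differential `m ⊗ b ↦ ρ m ⊗ b - m ⊗ Δ b + m ⊗ b ⊗ 1` of the cobar complex in degree
one. -/
def cobarOne (ρ : M →ₗ[k] M ⊗[k] B) : M ⊗[k] B →ₗ[k] M ⊗[k] (B ⊗[k] B) :=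
  (TensorProduct.assoc k M B B).toLinearMap ∘ₗ ρ.rTensor B - comul.lTensor M +
    ((TensorProduct.mk k B B).flip 1).lTensor M

/-- The first cohomology of the cobar complex of `ρ` vanishes. -/
def IsAcyclic (ρ : M →ₗ[k] M ⊗[k] B) : Prop :=
  ker (cobarOne ρ) ≤ range (cobarZero ρ)

theorem mem_coinvariants {ρ : M →ₗ[k] M ⊗[k] B} {m : M} :
    m ∈ coinvariants ρ ↔ ρ m = m ⊗ₜ[k] 1 :=
  Iff.rfl

theorem coinvariants_eq_ker (ρ : M →ₗ[k] M ⊗[k] B) : coinvariants ρ = ker (cobarZero ρ) :=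
  eqLocus_eq_ker_sub _ _

variable {ρL : L →ₗ[k] L ⊗[k] B} {ρ : M →ₗ[k] M ⊗[k] B} {ρN : N →ₗ[k] N ⊗[k] B}

theorem IsComodule.cobarOne_cobarZero (h : IsComodule ρ) (m : M) :
    cobarOne ρ (cobarZero ρ m) = 0 := by
  have hcoassoc := LinearMap.congr_fun h.coassoc m
  simp only [LinearMap.comp_apply, LinearEquiv.coe_coe] at hcoassoc
  simp only [cobarOne, cobarZero, LinearMap.add_apply, LinearMap.sub_apply, LinearMap.comp_apply,
    LinearEquiv.coe_coe, map_sub, hcoassoc, flip_apply, mk_apply, rTensor_tmul, lTensor_tmul,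
    Bialgebra.comul_one, Algebra.TensorProduct.one_def, sub_self]
  have hone : TensorProduct.assoc k M B B (ρ m ⊗ₜ[k] 1) =
      ((TensorProduct.mk k B B).flip 1).lTensor M (ρ m) := by
    generalize ρ m = x
    induction x with
    | zero => simp
    | add x y hx hy => simp only [add_tmul, map_add, hx, hy]
    | tmul m b => rfl
  rw [hone]
  abel

theorem IsComoduleHom.rTensor_cobarZero {f : M →ₗ[k] N} (hf : IsComoduleHom ρ ρN f) (m : M) :
    f.rTensor B (cobarZero ρ m) = cobarZero ρN (f m) := by
  simp only [cobarZero, LinearMap.sub_apply, map_sub, hf.apply]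
  rfl

theorem IsComoduleHom.rTensor_cobarOne {f : M →ₗ[k] N} (hf : IsComoduleHom ρ ρN f)
    (z : M ⊗[k] B) :
    f.rTensor (B ⊗[k] B) (cobarOne ρ z) = cobarOne ρN (f.rTensor B z) := by
  suffices f.rTensor (B ⊗[k] B) ∘ₗ cobarOne ρ = cobarOne ρN ∘ₗ f.rTensor B from
    LinearMap.congr_fun this z
  rw [cobarOne, cobarOne, comp_add, comp_sub, add_comp, sub_comp, ← hf.assoc_rTensor_comp]
  simp only [rTensor_comp_lTensor, lTensor_comp_rTensor, LinearMap.comp_assoc]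

section Exact

variable {j : L →ₗ[k] M} {q : M →ₗ[k] N} (hj : IsComoduleHom ρL ρ j) (hq : IsComoduleHom ρ ρN q)
  (hinj : Function.Injective j) (hex : Function.Exact j q) (hsurj : Function.Surjective q)

include hj hinj hex hsurj in
theorem exists_cobarZero_eq [Module.Flat k B] (hL : IsAcyclic ρL) {w : M ⊗[k] B}
    (hw : cobarOne ρ w = 0) (hqw : q.rTensor B w = 0) : ∃ l, cobarZero ρ (j l) = w := by
  obtain ⟨u, rfl⟩ := (rTensor_exact B hex hsurj w).1 hqw
  have hu : cobarOne ρL u = 0 := by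
    apply Module.Flat.rTensor_preserves_injective_linearMap (M := B ⊗[k] B) j hinj
    rw [map_zero, hj.rTensor_cobarOne, hw]
  obtain ⟨l, rfl⟩ := hL hu
  exact ⟨l, (hj.rTensor_cobarZero l).symm⟩

include hj hq hinj hex hsurj

theorem IsAcyclic.of_exact [Module.Flat k B] (hL : IsAcyclic ρL) (h : IsComodule ρ)
    (hN : IsAcyclic ρN) : IsAcyclic ρ := by
  intro z hz
  rw [mem_ker] at hz
  obtain ⟨n, hn⟩ := hN (x := q.rTensor B z) (by
    rw [mem_ker, ← hq.rTensor_cobarOne, hz, map_zero])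
  obtain ⟨m, rfl⟩ := hsurj n
  obtain ⟨l, hl⟩ := exists_cobarZero_eq (w := z - cobarZero ρ m) hj hinj hex hsurj hL
    (by rw [map_sub, hz, h.cobarOne_cobarZero, sub_zero])
    (by rw [map_sub, hq.rTensor_cobarZero, hn, sub_self])
  exact ⟨j l + m, by rw [map_add, hl, sub_add_cancel]⟩

theorem IsAcyclic.exists_mem_coinvariants [Module.Flat k B] (hL : IsAcyclic ρL)
    (h : IsComodule ρ) {n : N} (hn : n ∈ coinvariants ρN) : ∃ m ∈ coinvariants ρ, q m = n := by
  obtain ⟨m, rfl⟩ := hsurj n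
  rw [coinvariants_eq_ker, mem_ker] at hn
  obtain ⟨l, hl⟩ := exists_cobarZero_eq (w := cobarZero ρ m) hj hinj hex hsurj hL
    (h.cobarOne_cobarZero m) (by rw [hq.rTensor_cobarZero, hn])
  refine ⟨m - j l, ?_, by rw [map_sub, hex.apply_apply_eq_zero, sub_zero]⟩
  rw [coinvariants_eq_ker, mem_ker, map_sub, hl, sub_self]

end Exact

end Cobar

section TensorAct

open TensorProduct

variable {k R B M : Type*} [CommRing k] [Ring R] [Algebra k R] [Ring B] [Algebra k B]
  [AddCommGroup M] [Module k M] [Module R M] [IsScalarTower k R M]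

/-- The action `(r ⊗ c) (m ⊗ b) = r • m ⊗ c * b` of `R ⊗ B` on `M ⊗ B`. -/
def tensorAct : R ⊗[k] B →ₗ[k] M ⊗[k] B →ₗ[k] M ⊗[k] B :=
  TensorProduct.map₂ (Algebra.lsmul k k M).toLinearMap (LinearMap.mul k B)

@[simp]
theorem tensorAct_tmul (r : R) (c b : B) (m : M) :
    tensorAct (r ⊗ₜ[k] c) (m ⊗ₜ[k] b) = (r • m) ⊗ₜ[k] (c * b) := rfl

theorem tensorAct_eq_mul (x y : R ⊗[k] B) : tensorAct x y = x * y := by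
  have h : tensorAct = LinearMap.mul k (R ⊗[k] B) := by
    ext
    simp
  rw [h, LinearMap.mul_apply']

theorem rTensor_tensorAct {S N : Type*} [Ring S] [Algebra k S] [AddCommGroup N] [Module k N]
    [Module S N] [IsScalarTower k S N] (φ : R →ₗ[k] S) (f : M →ₗ[k] N)
    (hf : ∀ (r : R) (m : M), f (r • m) = φ r • f m) (x : R ⊗[k] B) (u : M ⊗[k] B) :
    f.rTensor B (tensorAct x u) = tensorAct (φ.rTensor B x) (f.rTensor B u) := by
  induction x with
  | zero => simp
  | add x y hx hy => simp only [map_add, LinearMap.add_apply, hx, hy]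
  | tmul r c =>
    induction u with
    | zero => simp
    | add x y hx hy => simp only [map_add, hx, hy]
    | tmul m b => simp [hf]

theorem tensorAct_one (x : M ⊗[k] B) : tensorAct (1 : R ⊗[k] B) x = x := by
  induction x with
  | zero => exact map_zero _
  | add x y hx hy => rw [map_add, hx, hy]
  | tmul m b => rw [Algebra.TensorProduct.one_def, tensorAct_tmul, one_smul, one_mul]

theorem tensorAct_mul_one_tmul (x : R ⊗[k] B) (b : B) (m : M) :
    tensorAct (x * 1 ⊗ₜ b) (m ⊗ₜ[k] 1) = tensorAct x (m ⊗ₜ[k] b) := by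
  induction x with
  | zero => simp
  | add x y hx hy => simp only [map_add, add_mul, LinearMap.add_apply, hx, hy]
  | tmul r c => simp

end TensorAct

section HopfModule

open Coalgebra TensorProduct LinearMap
open HopfAlgebra (antipode antipode_one)

variable {k B M : Type*} [CommRing k] [CommRing B] [HopfAlgebra k B]
  [AddCommGroup M] [Module k M] [Module B M] [IsScalarTower k B M]

/-- `ρ` makes the `B`-module `M` into a right Hopf module over `B`. -/
structure IsHopfModule (ρ : M →ₗ[k] M ⊗[k] B) : Prop extends IsComodule ρ where
  map_smul : ∀ (b : B) (m : M), ρ (b • m) = tensorAct (comul (R := k) b) (ρ m)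

/-- The map `m ⊗ b ↦ b • m`. -/
def act : M ⊗[k] B →ₗ[k] M := TensorProduct.lift (Algebra.lsmul k k M).toLinearMap.flip

/-- The map `m ⊗ b ↦ S b • m`. -/
def antipodeAct : M ⊗[k] B →ₗ[k] M := act ∘ₗ (antipode k).lTensor M

/-- The map `m ⊗ c ⊗ b ↦ Δ (S b) (m ⊗ c)`. -/
def comulAntipodeAct : M ⊗[k] (B ⊗[k] B) →ₗ[k] M ⊗[k] B :=
  TensorProduct.lift (tensorAct ∘ₗ comul ∘ₗ antipode k (A := B)).flip ∘ₗ
    (TensorProduct.assoc k M B B).symm.toLinearMap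

@[simp]
theorem act_tmul (m : M) (b : B) : act (m ⊗ₜ[k] b) = b • m := rfl

@[simp]
theorem antipodeAct_tmul (m : M) (b : B) : antipodeAct (m ⊗ₜ[k] b) = antipode k b • m := rfl

@[simp]
theorem comulAntipodeAct_tmul (m : M) (c b : B) :
    comulAntipodeAct (m ⊗ₜ[k] (c ⊗ₜ[k] b)) =
      tensorAct (comul (R := k) (antipode k b)) (m ⊗ₜ[k] c) := rfl

open WithConv Algebra.TensorProduct in
theorem mul'_map_includeRight_antipode_comul (b : B) :
    LinearMap.mul' k (B ⊗[k] B) (TensorProduct.map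
      (includeRight : B →ₐ[k] B ⊗[k] B).toLinearMap (comul ∘ₗ antipode k) (comul b)) =
      antipode k b ⊗ₜ[k] 1 := by
  let l : WithConv (B →ₐ[k] B ⊗[k] B) := toConv includeLeft
  let r : WithConv (B →ₐ[k] B ⊗[k] B) := toConv includeRight
  have hmul : l * r = toConv (Bialgebra.comulAlgHom k B) := by
    apply WithConv.ext
    apply AlgHom.toLinearMap_injective
    have hid : (lmul' k).comp (Algebra.TensorProduct.map (includeLeft (S := k))
        (includeRight : B →ₐ[k] B ⊗[k] B)) = AlgHom.id k (B ⊗[k] B) := by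
      ext <;> simp
    ext x
    exact congr($hid (comul x))
  have hinv : r * (toConv (Bialgebra.comulAlgHom k B))⁻¹ = l⁻¹ := by
    rw [← hmul]
    exact (congrArg (r * ·) (mul_inv_rev l r)).trans (mul_inv_cancel_left r l⁻¹)
  exact congr(($hinv).ofConv b)

theorem comulAntipodeAct_lTensor_comul :
    comulAntipodeAct ∘ₗ comul.lTensor M =
      (TensorProduct.mk k M B).flip 1 ∘ₗ antipodeAct := by
  refine TensorProduct.ext' fun m b => ?_
  have hact : comulAntipodeAct ∘ₗ TensorProduct.mk k M (B ⊗[k] B) m =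
      tensorAct.flip (m ⊗ₜ[k] 1) ∘ₗ LinearMap.mul' k (B ⊗[k] B) ∘ₗ TensorProduct.map
        (Algebra.TensorProduct.includeRight : B →ₐ[k] B ⊗[k] B).toLinearMap
        (comul ∘ₗ antipode k) := by
    refine TensorProduct.ext' fun c d => ?_
    simp only [LinearMap.comp_apply, mk_apply, comulAntipodeAct_tmul, TensorProduct.map_tmul,
      flip_apply, AlgHom.toLinearMap_apply, Algebra.TensorProduct.includeRight_apply, mul'_apply]
    rw [mul_comm, tensorAct_mul_one_tmul]
  have hb := LinearMap.congr_fun hact (comul b)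
  simp only [LinearMap.comp_apply, mul'_map_includeRight_antipode_comul, flip_apply,
    tensorAct_tmul, mk_apply, mul_one] at hb
  exact hb

theorem comulAntipodeAct_lTensor_one :
    comulAntipodeAct ∘ₗ ((TensorProduct.mk k B B).flip 1).lTensor M = LinearMap.id :=
  TensorProduct.ext' fun m b => by simp [tensorAct_one]

theorem antipodeAct_tensorAct (x : B ⊗[k] B) (u : M ⊗[k] B) :
    antipodeAct (tensorAct x u) =
      LinearMap.mul' k B ((antipode k).lTensor B x) • antipodeAct u := by
  induction x with
  | zero => simp
  | add x y hx hy => simp only [map_add, LinearMap.add_apply, add_smul, hx, hy]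
  | tmul c d =>
    induction u with
    | zero => simp
    | add x y hx hy => simp only [map_add, smul_add, hx, hy]
    | tmul m b =>
      simp only [tensorAct_tmul, antipodeAct_tmul, HopfAlgebra.antipode_mul_distrib, smul_smul,
        lTensor_tmul, mul'_apply]
      congr 1
      ring

theorem act_rTensor_antipodeAct :
    act ∘ₗ antipodeAct.rTensor B ∘ₗ (TensorProduct.assoc k M B B).symm.toLinearMap ∘ₗ
      comul.lTensor M = (TensorProduct.rid k M).toLinearMap ∘ₗ counit.lTensor M := by
  refine TensorProduct.ext' fun m b => ?_
  have hact : act ∘ₗ antipodeAct.rTensor B ∘ₗ (TensorProduct.assoc k M B B).symm.toLinearMap ∘ₗ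
      TensorProduct.mk k M (B ⊗[k] B) m =
        (toSpanSingleton B M m).restrictScalars k ∘ₗ LinearMap.mul' k B ∘ₗ
          (antipode k).rTensor B :=
    TensorProduct.ext' fun c d => by simp [smul_smul, mul_comm]
  have hb := LinearMap.congr_fun hact (comul b)
  simp only [LinearMap.comp_apply, HopfAlgebra.mul_antipode_rTensor_comul_apply] at hb
  simpa using hb

/-- The map `m ↦ ∑ S m₁ • m₀`, which projects a Hopf module onto its coinvariants. -/
def average (ρ : M →ₗ[k] M ⊗[k] B) : M →ₗ[k] M := antipodeAct ∘ₗ ρ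

variable {ρ : M →ₗ[k] M ⊗[k] B}

theorem average_of_mem_coinvariants {v : M} (hv : v ∈ coinvariants ρ) : average ρ v = v := by
  rw [average, LinearMap.comp_apply, mem_coinvariants.1 hv, antipodeAct_tmul, antipode_one,
    one_smul]

theorem IsComodule.act_rTensor_average (h : IsComodule ρ) (m : M) :
    act ((average ρ).rTensor B (ρ m)) = m := by
  have hassoc : ρ.rTensor B (ρ m) =
      (TensorProduct.assoc k M B B).symm (comul.lTensor M (ρ m)) :=
    (LinearEquiv.eq_symm_apply _).2 (LinearMap.congr_fun h.coassoc m)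
  have hact := LinearMap.congr_fun act_rTensor_antipodeAct (ρ m)
  have hcounit := LinearMap.congr_fun h.counit m
  simp only [LinearMap.comp_apply, LinearEquiv.coe_coe] at hact hcounit
  rw [average, rTensor_comp, LinearMap.comp_apply, hassoc, hact, hcounit]
  simp

namespace IsHopfModule

variable (h : IsHopfModule ρ)
include h

theorem coaction_antipodeAct :
    comulAntipodeAct ∘ₗ (TensorProduct.assoc k M B B).toLinearMap ∘ₗ ρ.rTensor B =
      ρ ∘ₗ antipodeAct := by
  refine TensorProduct.ext' fun m b => ?_
  simp [comulAntipodeAct, h.map_smul]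

theorem isAcyclic : IsAcyclic ρ := by
  intro z hz
  have hzero : ρ (antipodeAct z) - antipodeAct z ⊗ₜ[k] 1 + z = 0 :=
    calc ρ (antipodeAct z) - antipodeAct z ⊗ₜ[k] 1 + z
        = (ρ ∘ₗ antipodeAct) z - ((TensorProduct.mk k M B).flip 1 ∘ₗ antipodeAct) z +
            LinearMap.id (R := k) z := rfl
      _ = comulAntipodeAct (cobarOne ρ z) := by
          rw [← h.coaction_antipodeAct, ← comulAntipodeAct_lTensor_comul,
            ← comulAntipodeAct_lTensor_one]
          simp only [cobarOne, LinearMap.add_apply, LinearMap.sub_apply, map_add, map_sub]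
          rfl
      _ = 0 := by rw [mem_ker.1 hz, map_zero]
  refine ⟨-antipodeAct z, ?_⟩
  rw [map_neg, neg_eq_iff_add_eq_zero]
  exact hzero

theorem average_mem_coinvariants (m : M) : average ρ m ∈ coinvariants ρ :=
  calc ρ (antipodeAct (ρ m))
      = comulAntipodeAct (((TensorProduct.assoc k M B B).toLinearMap ∘ₗ ρ.rTensor B ∘ₗ ρ) m) :=
        (LinearMap.congr_fun h.coaction_antipodeAct (ρ m)).symm
    _ = antipodeAct (ρ m) ⊗ₜ[k] 1 := by
        rw [h.coassoc]
        exact LinearMap.congr_fun comulAntipodeAct_lTensor_comul (ρ m)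

theorem average_smul (b : B) (m : M) : average ρ (b • m) = counit (R := k) b • average ρ m := by
  rw [average, LinearMap.comp_apply, h.map_smul, antipodeAct_tensorAct,
    HopfAlgebra.mul_antipode_lTensor_comul_apply, algebraMap_smul, LinearMap.comp_apply]

theorem span_coinvariants : Submodule.span B (coinvariants ρ : Set M) = ⊤ := by
  refine eq_top_iff.2 fun m _ => ?_
  rw [← h.act_rTensor_average m]
  induction ρ m with
  | zero => simp
  | add x y hx hy => simpa only [map_add] using Submodule.add_mem _ hx hy
  | tmul m b => exact Submodule.smul_mem _ _ (Submodule.subset_span (h.average_mem_coinvariants m))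

theorem rTensor_average_coaction_smul {v : M} (hv : v ∈ coinvariants ρ) (b : B) :
    (average ρ).rTensor B (ρ (b • v)) = v ⊗ₜ[k] b := by
  have hact : (average ρ).rTensor B ∘ₗ (tensorAct (R := B)).flip (v ⊗ₜ[k] 1) =
      TensorProduct.mk k M B v ∘ₗ (TensorProduct.lid k B).toLinearMap ∘ₗ counit.rTensor B :=
    TensorProduct.ext' fun c d => by
      simp [h.average_smul, average_of_mem_coinvariants hv, TensorProduct.smul_tmul]
  have hb := LinearMap.congr_fun hact (comul b)
  simp only [LinearMap.comp_apply, rTensor_counit_comul, flip_apply] at hb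
  rw [h.map_smul, mem_coinvariants.1 hv, hb]
  simp

theorem linearIndependent [Module.Flat k B] {ι : Type*} {v : ι → M}
    (hv : ∀ i, v i ∈ coinvariants ρ) (hli : LinearIndependent k v) : LinearIndependent B v := by
  classical
  have hcomp : (average ρ).rTensor B ∘ₗ ρ ∘ₗ (Finsupp.linearCombination B v).restrictScalars k =
      (Finsupp.linearCombination k v).rTensor B ∘ₗ
        (TensorProduct.finsuppScalarLeft k B ι).symm.toLinearMap := by
    refine Finsupp.lhom_ext fun i b => ?_
    simp [h.rTensor_average_coaction_smul (hv i)]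
  refine Function.Injective.of_comp (f := (average ρ).rTensor B ∘ₗ ρ) ?_
  have hinj := (Module.Flat.rTensor_preserves_injective_linearMap (M := B) _ hli).comp
    (TensorProduct.finsuppScalarLeft k B ι).symm.injective
  exact fun x y hxy => hinj ((LinearMap.congr_fun hcomp x).symm.trans
    (hxy.trans (LinearMap.congr_fun hcomp y)))

theorem coinvariants_le_span {ι : Type*} {v : ι → M} (hv : ∀ i, v i ∈ coinvariants ρ)
    (hspan : Submodule.span B (Set.range v) = ⊤) :
    coinvariants ρ ≤ Submodule.span k (Set.range v) := by
  have haverage : ∀ m, average ρ m ∈ Submodule.span k (Set.range v) := by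
    intro m
    induction (hspan ▸ Submodule.mem_top : m ∈ Submodule.span B (Set.range v))
      using Submodule.span_induction with
    | mem x hx =>
      obtain ⟨i, rfl⟩ := hx
      rw [average_of_mem_coinvariants (hv i)]
      exact Submodule.subset_span ⟨i, rfl⟩
    | zero => rw [map_zero]; exact Submodule.zero_mem _
    | add x y _ _ hx hy => rw [map_add]; exact Submodule.add_mem _ hx hy
    | smul b x _ hx => rw [h.average_smul]; exact Submodule.smul_mem _ _ hx
  exact fun m hm => average_of_mem_coinvariants hm ▸ haverage m

end IsHopfModule

end HopfModule

section Ideals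

variable {R : Type*} [Ring R]

theorem list_prod_mem_pow {K : Ideal R} [K.IsTwoSided] {l : List R} (hl : ∀ x ∈ l, x ∈ K) :
    l.prod ∈ K ^ l.length := by
  induction l with
  | nil => simp [Submodule.pow_zero]
  | cons x l ih =>
    rw [List.prod_cons, List.length_cons, Ideal.IsTwoSided.pow_succ]
    exact Ideal.mul_mem_mul (hl x List.mem_cons_self)
      (ih fun z hz => hl z (List.mem_cons_of_mem _ hz))

theorem le_of_le_sup_pow_two {I K : Ideal R} [K.IsTwoSided] {N : ℕ} (hN : K ^ N = ⊥)
    (h : K ≤ I ⊔ K ^ 2) : K ≤ I := by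
  have le_sup_pow : ∀ n, K ≤ I ⊔ K ^ (n + 1) := fun n => by
    induction n with
    | zero => simp [Submodule.pow_one]
    | succ n ih =>
      refine h.trans (sup_le le_sup_left ?_)
      calc K ^ 2 = K * K := by rw [Ideal.IsTwoSided.pow_succ, Submodule.pow_one]
        _ ≤ K * (I ⊔ K ^ (n + 1)) := Ideal.mul_mono_right ih
        _ = K * I ⊔ K ^ (n + 2) := by rw [Ideal.mul_sup, ← Ideal.IsTwoSided.pow_succ]
        _ ≤ I ⊔ K ^ (n + 2) := sup_le_sup_right (Ideal.mul_le_right) _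
  have hbot : K ^ (N + 1) = ⊥ := le_bot_iff.1 ((Ideal.pow_le_pow_right N.le_succ).trans hN.le)
  simpa only [hbot, sup_bot_eq] using le_sup_pow N

end Ideals

section TwistedDerivation

variable {R : Type*} [Ring R] {σ : R → R} {D : R →+ R}

/-- The additive map `D` is a derivation twisted by `σ`. For the parity automorphism `σ` of a
super algebra, these are the odd superderivations. -/
def IsTwistedDerivation (σ : R → R) (D : R →+ R) : Prop :=
  ∀ a b, D (a * b) = D a * b + σ a * D b

namespace IsTwistedDerivation

variable (hD : IsTwistedDerivation σ D) {K : Ideal R} [K.IsTwoSided] (hσ : ∀ a ∈ K, σ a ∈ K)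

include hD hσ

theorem map_mem_pow {n : ℕ} {x : R} (hx : x ∈ K ^ (n + 1)) : D x ∈ K ^ n := by
  induction n generalizing x with
  | zero => simp [Submodule.pow_zero]
  | succ n ih =>
    rw [Ideal.IsTwoSided.pow_succ] at hx
    induction hx using Submodule.smul_induction_on' with
    | smul a ha b hb =>
      rw [smul_eq_mul, hD]
      refine Ideal.add_mem _ (Ideal.mul_mem_left _ _ hb) ?_
      rw [Ideal.IsTwoSided.pow_succ]
      exact Ideal.mul_mem_mul (hσ a ha) (ih hb)
    | add x _ y _ hx hy => rw [map_add]; exact Ideal.add_mem _ hx hy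

theorem map_list_prod_mem_pow {l : List R} (hl : ∀ x ∈ l, x ∈ K) (hDl : ∀ x ∈ l, D x ∈ K) :
    D l.prod ∈ K ^ l.length := by
  induction l with
  | nil => simp [Submodule.pow_zero]
  | cons x l ih =>
    rw [List.forall_mem_cons] at hl hDl
    rw [List.prod_cons, List.length_cons, hD, Ideal.IsTwoSided.pow_succ]
    exact Ideal.add_mem _ (Ideal.mul_mem_mul hDl.1 (list_prod_mem_pow hl.2))
      (Ideal.mul_mem_mul (hσ x hl.1) (ih hl.2 hDl.2))

end IsTwistedDerivation

theorem list_prod_notMem_pow_of_dual {ι : Type*} {y : ι → R} {K : Ideal R} [K.IsTwoSided]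
    (hK : K ≠ ⊤) (hσ : ∀ a ∈ K, σ a ∈ K) (hy : ∀ i, y i ∈ K)
    (hdual : ∀ i, ∃ D : R →+ R, IsTwistedDerivation σ D ∧ D (y i) - 1 ∈ K ∧
      ∀ j, j ≠ i → D (y j) ∈ K)
    {l : List ι} (hl : l.Nodup) : (l.map y).prod ∉ K ^ (l.length + 1) := by
  induction l with
  | nil => simpa [Submodule.pow_one, Ideal.eq_top_iff_one] using hK
  | cons i l ih =>
    obtain ⟨hil, hl⟩ := List.nodup_cons.1 hl
    obtain ⟨D, hD, hDi, hDj⟩ := hdual i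
    have hyl : ∀ x ∈ l.map y, x ∈ K := List.forall_mem_map.2 fun j _ => hy j
    have hDl : ∀ x ∈ l.map y, D x ∈ K :=
      List.forall_mem_map.2 fun j hj => hDj j (ne_of_mem_of_not_mem hj hil)
    have hσD : σ (y i) * D (l.map y).prod ∈ K ^ (l.length + 1) := by
      have h := Ideal.mul_mem_mul (hσ _ (hy i)) (hD.map_list_prod_mem_pow hσ hyl hDl)
      rwa [← Ideal.IsTwoSided.pow_succ, List.length_map] at h
    have hD1 : (D (y i) - 1) * (l.map y).prod ∈ K ^ (l.length + 1) := by
      have h := Ideal.mul_mem_mul hDi (list_prod_mem_pow hyl)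
      rwa [← Ideal.IsTwoSided.pow_succ, List.length_map] at h
    intro hmem
    have hDmem := hD.map_mem_pow hσ hmem
    rw [List.map_cons, List.prod_cons, hD, List.length_cons] at hDmem
    refine ih hl ?_
    convert Ideal.sub_mem _ (Ideal.sub_mem _ hDmem hσD) hD1 using 1
    noncomm_ring

end TwistedDerivation

section Anticommuting

variable {ι k R : Type*} [Ring R] {y : ι → R}

/-- A family of elements of square zero which anticommute with each other, such as the generators
of an exterior algebra. -/
structure IsAnticommuting (y : ι → R) : Prop where
  sq : ∀ i, y i * y i = 0
  anti : ∀ i j, y i * y j = -(y j * y i)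

namespace IsAnticommuting

variable (hy : IsAnticommuting y)

include hy

theorem mul_self_of_mem_span [CommRing k] [Algebra k R] {x : R}
    (hx : x ∈ Submodule.span k (Set.range y)) : x * x = 0 := by
  have anti {x z : R} (hx : x ∈ Submodule.span k (Set.range y))
      (hz : z ∈ Submodule.span k (Set.range y)) : x * z = -(z * x) := by
    induction hx, hz using Submodule.span_induction₂ with
    | mem_mem x z hx hz =>
      obtain ⟨i, rfl⟩ := hx
      obtain ⟨j, rfl⟩ := hz
      exact hy.anti i j
    | zero_left => simp
    | zero_right => simp
    | add_left x x' z _ _ _ h h' => rw [add_mul, mul_add, h, h', neg_add]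
    | add_right x z z' _ _ _ h h' => rw [add_mul, mul_add, h, h', neg_add]
    | smul_left c x z _ _ h => rw [smul_mul_assoc, mul_smul_comm, h, smul_neg]
    | smul_right c x z _ _ h => rw [smul_mul_assoc, mul_smul_comm, h, smul_neg]
  induction hx using Submodule.span_induction with
  | mem x hx =>
    obtain ⟨i, rfl⟩ := hx
    exact hy.sq i
  | zero => simp
  | add x z hx hz hxx hzz => rw [add_mul, mul_add, mul_add, hxx, hzz, anti hx hz]; simp
  | smul c x _ hxx => rw [smul_mul_smul_comm, hxx, smul_zero]

theorem mul_prod_of_mem {i : ι} {l : List ι} (hi : i ∈ l) : y i * (l.map y).prod = 0 := by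
  induction l with
  | nil => simp at hi
  | cons j l ih =>
    rw [List.map_cons, List.prod_cons, ← mul_assoc]
    rcases List.mem_cons.1 hi with rfl | h
    · rw [hy.sq, zero_mul]
    · rw [hy.anti, neg_mul, mul_assoc, ih h, mul_zero, neg_zero]

theorem prod_eq_zero {l : List ι} (hl : ¬ l.Nodup) : (l.map y).prod = 0 := by
  induction l with
  | nil => simp at hl
  | cons j l ih =>
    rw [List.map_cons, List.prod_cons]
    by_cases h : j ∈ l
    · exact hy.mul_prod_of_mem h
    · rw [ih (fun hn => hl (List.nodup_cons.2 ⟨h, hn⟩)), mul_zero]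

theorem prod_perm {l l' : List ι} (h : l.Perm l') :
    (l.map y).prod = (l'.map y).prod ∨ (l.map y).prod = -(l'.map y).prod := by
  induction h with
  | nil => simp
  | cons i _ ih =>
    simp only [List.map_cons, List.prod_cons]
    exact ih.imp (fun e => by rw [e]) (fun e => by rw [e, mul_neg])
  | swap i j l =>
    refine Or.inr ?_
    simp only [List.map_cons, List.prod_cons]
    rw [← mul_assoc, hy.anti, neg_mul, mul_assoc]
  | trans _ _ ih ih' =>
    rcases ih with e | e <;> rcases ih' with e' | e' <;> rw [e, e'] <;> simp

end IsAnticommuting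

theorem isAnticommuting_ι {M : Type*} [CommRing k] [AddCommGroup M] [Module k M] (v : ι → M) :
    IsAnticommuting fun i => ExteriorAlgebra.ι k (v i) where
  sq i := ExteriorAlgebra.ι_sq_zero (v i)
  anti i j := eq_neg_of_add_eq_zero_left (ExteriorAlgebra.ι_add_mul_swap (v i) (v j))

variable [LinearOrder ι]

/-- The monomial `∏ i ∈ I, y i`, the factors being taken in increasing order. -/
def monomial (y : ι → R) (I : Finset ι) : R := (I.sort.map y).prod

theorem map_monomial {R' F : Type*} [Ring R'] [FunLike F R R'] [MonoidHomClass F R R'] (f : F)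
    (I : Finset ι) : f (monomial y I) = monomial (fun i => f (y i)) I := by
  rw [monomial, map_list_prod, List.map_map]
  rfl

theorem monomial_mem_pow {K : Ideal R} [K.IsTwoSided] (hy : ∀ i, y i ∈ K) (I : Finset ι) :
    monomial y I ∈ K ^ I.card := by
  have h : (I.sort.map y).prod ∈ K ^ (I.sort.map y).length :=
    list_prod_mem_pow (List.forall_mem_map.2 fun i _ => hy i)
  rwa [List.length_map, Finset.length_sort] at h

namespace IsAnticommuting

variable (hy : IsAnticommuting y)

include hy

theorem monomial_mul_monomial_of_not_disjoint {I I' : Finset ι} (h : ¬ Disjoint I I') :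
    monomial y I * monomial y I' = 0 := by
  rw [monomial, monomial, ← List.prod_append, ← List.map_append]
  refine hy.prod_eq_zero fun hn => h ?_
  simpa [List.Disjoint, Finset.disjoint_left] using (List.nodup_append'.1 hn).2.2

theorem prod_mem_span (S : Type*) [Ring S] [Module S R] (l : List ι) :
    (l.map y).prod ∈ Submodule.span S (monomial y '' {I | I.card = l.length}) := by
  by_cases hl : l.Nodup
  · have hperm : l.Perm l.toFinset.sort := by
      rw [List.perm_ext_iff_of_nodup hl (Finset.sort_nodup ..)]
      simp
    have hmem : monomial y l.toFinset ∈ Submodule.span S (monomial y '' {I | I.card = l.length}) :=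
      Submodule.subset_span ⟨_, List.toFinset_card_of_nodup hl, rfl⟩
    rcases hy.prod_perm hperm with e | e <;> rw [e]
    exacts [hmem, Submodule.neg_mem _ hmem]
  · rw [hy.prod_eq_zero hl]
    exact Submodule.zero_mem _

theorem span_monomial_of_adjoin [CommRing k] [Algebra k R]
    (h : Algebra.adjoin k (Set.range y) = ⊤) :
    Submodule.span k (Set.range (monomial y)) = ⊤ := by
  rw [eq_top_iff, ← Algebra.top_toSubmodule, ← h, Algebra.adjoin_eq_span, Submodule.span_le]
  intro x hx
  obtain ⟨l, hl, rfl⟩ := Submonoid.exists_list_of_mem_closure hx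
  obtain ⟨l, rfl⟩ : l ∈ Set.range (List.map y) := by
    rw [Set.range_list_map]
    exact hl
  exact Submodule.span_mono (Set.image_subset_range _ _) (hy.prod_mem_span k l)

theorem mul_mem_span_monomial (hc : ∀ i c, ∃ c', y i * c = c' * y i) {n : ℕ} {x z : R}
    (hx : x ∈ Ideal.span (Set.range y)) (hz : z ∈ Ideal.span (monomial y '' {I | I.card = n})) :
    x * z ∈ Ideal.span (monomial y '' {I | I.card = n + 1}) := by
  induction hx using Submodule.span_induction with
  | zero => simp
  | add x x' _ _ h h' => rw [add_mul]; exact Ideal.add_mem _ h h'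
  | smul a x _ h => rw [smul_eq_mul, mul_assoc]; exact Ideal.mul_mem_left _ a h
  | mem x hx =>
    obtain ⟨i, rfl⟩ := hx
    induction hz using Submodule.span_induction with
    | zero => simp
    | add x x' _ _ h h' => rw [mul_add]; exact Ideal.add_mem _ h h'
    | smul a x _ h =>
      obtain ⟨c, hc⟩ := hc i a
      rw [smul_eq_mul, ← mul_assoc, hc, mul_assoc]
      exact Ideal.mul_mem_left _ c h
    | mem x hx =>
      obtain ⟨I, hI, rfl⟩ := hx
      have h := hy.prod_mem_span R (i :: I.sort)
      rwa [List.length_cons, Finset.length_sort, hI] at h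

theorem pow_le_span_monomial (hc : ∀ i c, ∃ c', y i * c = c' * y i) {K : Ideal R} [K.IsTwoSided]
    (hK : K ≤ Ideal.span (Set.range y)) (n : ℕ) :
    K ^ n ≤ Ideal.span (monomial y '' {I | I.card = n}) := by
  induction n with
  | zero =>
    have h1 : (1 : R) ∈ Ideal.span (monomial y '' {I | I.card = 0}) := hy.prod_mem_span R []
    rw [(Ideal.eq_top_iff_one _).2 h1]
    exact le_top
  | succ n ih =>
    rw [Ideal.IsTwoSided.pow_succ, Ideal.mul_le]
    exact fun x hx z hz => hy.mul_mem_span_monomial hc (hK hx) (ih hz)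

end IsAnticommuting

theorem monomial_mul_monomial_compl_notMem_pow [Fintype ι] {K : Ideal R}
    (hprod : ∀ l : List ι, l.Nodup → (l.map y).prod ∉ K ^ (l.length + 1)) (I : Finset ι) :
    monomial y I * monomial y Iᶜ ∉ K ^ (Fintype.card ι + 1) := by
  have hnodup : (I.sort ++ (Iᶜ).sort).Nodup :=
    List.nodup_append'.2 ⟨I.sort_nodup _, Iᶜ.sort_nodup _, fun i hi hi' => by simp_all⟩
  have h := hprod _ hnodup
  rwa [List.map_append, List.prod_append, List.length_append, Finset.length_sort,
    Finset.length_sort, Finset.card_add_card_compl] at h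

theorem span_monomial_ι [Finite ι] [CommRing k] :
    Submodule.span k (Set.range (monomial fun i : ι =>
      ExteriorAlgebra.ι k (Pi.single i (1 : k) : ι → k))) = ⊤ := by
  cases nonempty_fintype ι
  refine (isAnticommuting_ι _).span_monomial_of_adjoin
    (top_le_iff.1 (CliffordAlgebra.adjoin_range_ι.ge.trans (Algebra.adjoin_le ?_)))
  rintro _ ⟨v, rfl⟩
  rw [← (Pi.basisFun k ι).sum_repr v, map_sum]
  refine Subalgebra.sum_mem _ fun i _ => ?_
  rw [map_smul, Pi.basisFun_apply]
  exact Subalgebra.smul_mem _ (Algebra.subset_adjoin (Set.mem_range_self i)) _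

namespace IsAnticommuting

variable (hy : IsAnticommuting y)

include hy

theorem pow_eq_bot [Fintype ι] (hc : ∀ i c, ∃ c', y i * c = c' * y i) {K : Ideal R} [K.IsTwoSided]
    (hK : K ≤ Ideal.span (Set.range y)) {n : ℕ} (hn : Fintype.card ι < n) : K ^ n = ⊥ := by
  have hempty : {I : Finset ι | I.card = n} = ∅ :=
    Set.eq_empty_of_forall_notMem fun I hI => (I.card_le_univ.trans_lt hn).ne hI
  simpa [hempty] using hy.pow_le_span_monomial hc hK n

theorem coeff_eq_zero [Finite ι] [Field k] [Algebra k R] {K : Ideal R} [K.IsTwoSided]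
    (hyK : ∀ i, y i ∈ K)
    (hprod : ∀ l : List ι, l.Nodup → (l.map y).prod ∉ K ^ (l.length + 1))
    {κ : Type*} [Fintype κ] {f : κ → Finset ι} (hf : Function.Injective f) {n : ℕ} {c : κ → k}
    (hc : ∑ b, c b • monomial y (f b) ∈ K ^ (n + 1)) {a : κ} (ha : (f a).card ≤ n) : c a = 0 := by
  cases nonempty_fintype ι
  induction hp : (f a).card using Nat.strong_induction_on generalizing a with
  | _ p ih =>
  subst hp
  by_contra h0
  have hne : ∀ b ≠ a, c b • (monomial y (f b) * monomial y (f a)ᶜ) = 0 := fun b hb => by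
    by_cases hle : f b ⊆ f a
    · have hlt := Finset.card_lt_card (hle.ssubset_of_ne (hf.ne hb))
      rw [ih _ hlt (hlt.le.trans ha) rfl, zero_smul]
    · rw [hy.monomial_mul_monomial_of_not_disjoint (by rwa [disjoint_compl_right_iff]), smul_zero]
  have hmem : c a • (monomial y (f a) * monomial y (f a)ᶜ) ∈ K ^ (Fintype.card ι + 1) := by
    have h := Ideal.mul_mem_mul hc (monomial_mem_pow hyK (f a)ᶜ)
    rw [← Ideal.IsTwoSided.pow_add, Finset.sum_mul] at h
    simp only [smul_mul_assoc] at h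
    rw [Fintype.sum_eq_single a hne] at h
    refine Ideal.pow_le_pow_right ?_ h
    have := Finset.card_add_card_compl (f a)
    omega
  refine monomial_mul_monomial_compl_notMem_pow hprod (f a) ?_
  simpa [smul_smul, h0] using Submodule.smul_of_tower_mem _ (c a)⁻¹ hmem

theorem exists_exteriorEquiv [Finite ι] [CommRing k] [Algebra k R]
    (hli : LinearIndependent k (monomial y))
    (hspan : Submodule.span k (Set.range (monomial y)) = ⊤) :
    ∃ e : ExteriorAlgebra k (ι → k) ≃ₐ[k] R,
      ∀ i, e (ExteriorAlgebra.ι k (Pi.single i 1)) = y i := by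
  cases nonempty_fintype ι
  let f : ExteriorAlgebra k (ι → k) →ₐ[k] R :=
    ExteriorAlgebra.lift k ⟨Fintype.linearCombination k y, fun v => hy.mul_self_of_mem_span
      (Fintype.range_linearCombination k y ▸ LinearMap.mem_range_self _ v)⟩
  have f_gen (i : ι) : f (ExteriorAlgebra.ι k (Pi.single i 1)) = y i := by
    simp [f, Fintype.linearCombination_apply_single]
  have f_monomial : f.toLinearMap ∘ monomial (fun i => ExteriorAlgebra.ι k (Pi.single i 1)) =
      monomial y := by
    funext I
    simp [map_monomial, f_gen]
  have hinj : Function.Injective f := by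
    have h := Submodule.range_ker_disjoint (f_monomial ▸ hli)
    rw [span_monomial_ι, top_disjoint] at h
    exact LinearMap.ker_eq_bot.1 h
  have hsurj : LinearMap.range f.toLinearMap = ⊤ := by
    rw [← top_le_iff, ← hspan, ← f_monomial, Submodule.span_le]
    exact Set.range_comp_subset_range _ _
  exact ⟨AlgEquiv.ofBijective f ⟨hinj, LinearMap.range_eq_top.1 hsurj⟩, f_gen⟩

end IsAnticommuting

end Anticommuting

section Parts

variable {k A : Type*} [CommRing k] [Ring A] [Algebra k A]
variable (𝒜 : ZMod 2 → Submodule k A) [GradedAlgebra 𝒜]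

/-- The projection onto the even part. -/
abbrev evenPart : A →ₗ[k] A := GradedAlgebra.proj 𝒜 0

/-- The projection onto the odd part. -/
abbrev oddPart : A →ₗ[k] A := GradedAlgebra.proj 𝒜 1

theorem evenPart_mem (a : A) : evenPart 𝒜 a ∈ 𝒜 0 := SetLike.coe_mem _

theorem oddPart_mem (a : A) : oddPart 𝒜 a ∈ 𝒜 1 := SetLike.coe_mem _

theorem evenPart_of_even {a : A} (ha : a ∈ 𝒜 0) : evenPart 𝒜 a = a :=
  DirectSum.decompose_of_mem_same 𝒜 ha

theorem oddPart_of_odd {a : A} (ha : a ∈ 𝒜 1) : oddPart 𝒜 a = a :=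
  DirectSum.decompose_of_mem_same 𝒜 ha

theorem evenPart_of_odd {a : A} (ha : a ∈ 𝒜 1) : evenPart 𝒜 a = 0 :=
  DirectSum.decompose_of_mem_ne 𝒜 ha one_ne_zero

theorem oddPart_of_even {a : A} (ha : a ∈ 𝒜 0) : oddPart 𝒜 a = 0 :=
  DirectSum.decompose_of_mem_ne 𝒜 ha zero_ne_one

theorem even_mul_even {a b : A} (ha : a ∈ 𝒜 0) (hb : b ∈ 𝒜 0) : a * b ∈ 𝒜 0 :=
  SetLike.mul_mem_graded ha hb

theorem even_mul_odd {a b : A} (ha : a ∈ 𝒜 0) (hb : b ∈ 𝒜 1) : a * b ∈ 𝒜 1 :=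
  SetLike.mul_mem_graded ha hb

theorem odd_mul_even {a b : A} (ha : a ∈ 𝒜 1) (hb : b ∈ 𝒜 0) : a * b ∈ 𝒜 1 :=
  SetLike.mul_mem_graded ha hb

theorem odd_mul_odd {a b : A} (ha : a ∈ 𝒜 1) (hb : b ∈ 𝒜 1) : a * b ∈ 𝒜 0 :=
  SetLike.mul_mem_graded ha hb

theorem evenPart_add_oddPart (a : A) : evenPart 𝒜 a + oddPart 𝒜 a = a := by
  have h := DirectSum.sum_univ_of (DirectSum.decompose 𝒜 a)
  apply_fun (DirectSum.decompose 𝒜).symm at h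
  rw [Equiv.symm_apply_apply, DirectSum.decompose_symm_sum] at h
  simp only [DirectSum.decompose_symm_of] at h
  exact (Fin.sum_univ_two _).symm.trans h

theorem exists_even_add_odd (a : A) : ∃ b ∈ 𝒜 0, ∃ c ∈ 𝒜 1, a = b + c :=
  ⟨_, evenPart_mem 𝒜 a, _, oddPart_mem 𝒜 a, (evenPart_add_oddPart 𝒜 a).symm⟩

theorem evenPart_mul (a b : A) : evenPart 𝒜 (a * b) =
    evenPart 𝒜 a * evenPart 𝒜 b + oddPart 𝒜 a * oddPart 𝒜 b := by
  obtain ⟨a0, ha0, a1, ha1, rfl⟩ := exists_even_add_odd 𝒜 a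
  obtain ⟨b0, hb0, b1, hb1, rfl⟩ := exists_even_add_odd 𝒜 b
  simp only [mul_add, add_mul, map_add, evenPart_of_even 𝒜 ha0, evenPart_of_even 𝒜 hb0,
    oddPart_of_odd 𝒜 ha1, oddPart_of_odd 𝒜 hb1, evenPart_of_odd 𝒜 ha1, evenPart_of_odd 𝒜 hb1,
    oddPart_of_even 𝒜 ha0, oddPart_of_even 𝒜 hb0, evenPart_of_even 𝒜 (even_mul_even 𝒜 ha0 hb0),
    evenPart_of_odd 𝒜 (even_mul_odd 𝒜 ha0 hb1), evenPart_of_odd 𝒜 (odd_mul_even 𝒜 ha1 hb0),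
    evenPart_of_even 𝒜 (odd_mul_odd 𝒜 ha1 hb1), add_zero, zero_add]

theorem oddPart_mul (a b : A) : oddPart 𝒜 (a * b) =
    evenPart 𝒜 a * oddPart 𝒜 b + oddPart 𝒜 a * evenPart 𝒜 b := by
  have h := evenPart_add_oddPart 𝒜 (a * b)
  conv_rhs at h => rw [← evenPart_add_oddPart 𝒜 a, ← evenPart_add_oddPart 𝒜 b]
  rw [evenPart_mul] at h
  rw [← sub_eq_zero] at h ⊢
  rw [← h]
  noncomm_ring

end Parts

theorem tensorPart_le_iff {k A : Type*} [Field k] [Ring A] [Algebra k A]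
    {𝒜 : ZMod 2 → Submodule k A} {i : ZMod 2} {W : Submodule k (A ⊗[k] A)} :
    tensorPart 𝒜 i ≤ W ↔ ∀ p, ∀ a ∈ 𝒜 p, ∀ b ∈ 𝒜 (i - p), a ⊗ₜ b ∈ W := by
  simp only [tensorPart, iSup_le_iff, TensorProduct.range_map, Submodule.range_subtype,
    Submodule.map₂_le, TensorProduct.mk_apply]

section Parity

variable {k A : Type*} [Field k] [Ring A] [Algebra k A]
variable (𝒜 : ZMod 2 → Submodule k A) [GradedAlgebra 𝒜]

theorem parity_apply (a : A) : parity 𝒜 a = evenPart 𝒜 a - oddPart 𝒜 a := rfl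

theorem parity_even {a : A} (ha : a ∈ 𝒜 0) : parity 𝒜 a = a := by
  rw [parity_apply, evenPart_of_even 𝒜 ha, oddPart_of_even 𝒜 ha, sub_zero]

theorem parity_odd {a : A} (ha : a ∈ 𝒜 1) : parity 𝒜 a = -a := by
  rw [parity_apply, evenPart_of_odd 𝒜 ha, oddPart_of_odd 𝒜 ha, zero_sub]

theorem parity_mem {i : ZMod 2} {a : A} (ha : a ∈ 𝒜 i) : parity 𝒜 a ∈ 𝒜 i := by
  rcases eq_zero_or_one i with rfl | rfl
  · rwa [parity_even 𝒜 ha]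
  · rw [parity_odd 𝒜 ha]
    exact Submodule.neg_mem _ ha

theorem parity_parity (a : A) : parity 𝒜 (parity 𝒜 a) = a := by
  obtain ⟨b, hb, c, hc, rfl⟩ := exists_even_add_odd 𝒜 a
  rw [map_add, map_add, parity_even 𝒜 hb, parity_odd 𝒜 hc, map_neg, parity_even 𝒜 hb,
    parity_odd 𝒜 hc, neg_neg]

theorem parity_mul (a b : A) : parity 𝒜 (a * b) = parity 𝒜 a * parity 𝒜 b := by
  simp only [parity_apply, evenPart_mul, oddPart_mul, mul_sub, sub_mul]
  abel

end Parity

section SuperCommutative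

variable {k A : Type*} [Field k] [Ring A] [Algebra k A] [Coalgebra k A]
variable (𝒜 : ZMod 2 → Submodule k A) [GradedAlgebra 𝒜] [IsSuperAffineHopfAlgebra 𝒜]

theorem comul_parity (a : A) : Coalgebra.comul (R := k) (parity 𝒜 a) =
    TensorProduct.map (parity 𝒜) (parity 𝒜) (Coalgebra.comul a) := by
  have h0 : tensorPart 𝒜 0 ≤
      LinearMap.eqLocus (TensorProduct.map (parity 𝒜) (parity 𝒜)) LinearMap.id := by
    refine tensorPart_le_iff.2 fun p a ha b hb => ?_
    rw [LinearMap.mem_eqLocus, TensorProduct.map_tmul]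
    rcases eq_zero_or_one p with rfl | rfl
    · rw [parity_even 𝒜 ha, parity_even 𝒜 hb, LinearMap.id_apply]
    · rw [parity_odd 𝒜 ha, parity_odd 𝒜 hb, TensorProduct.neg_tmul, TensorProduct.tmul_neg,
        neg_neg, LinearMap.id_apply]
  have h1 : tensorPart 𝒜 1 ≤
      LinearMap.eqLocus (TensorProduct.map (parity 𝒜) (parity 𝒜)) (-LinearMap.id) := by
    refine tensorPart_le_iff.2 fun p a ha b hb => ?_
    rw [LinearMap.mem_eqLocus, TensorProduct.map_tmul]
    rcases eq_zero_or_one p with rfl | rfl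
    · rw [parity_even 𝒜 ha, parity_odd 𝒜 hb, TensorProduct.tmul_neg]
      rfl
    · rw [parity_odd 𝒜 ha, parity_even 𝒜 hb, TensorProduct.neg_tmul]
      rfl
  obtain ⟨b, hb, c, hc, rfl⟩ := even_add_odd 𝒜 a
  rw [map_add, map_add, map_add, map_add, parity_even 𝒜 hb, parity_odd 𝒜 hc,
    h0 (IsSuperAffineHopfAlgebra.comul_mem 0 b hb),
    h1 (IsSuperAffineHopfAlgebra.comul_mem 1 c hc), map_neg]
  rfl

theorem odd_anticomm {a b : A} (ha : a ∈ 𝒜 1) (hb : b ∈ 𝒜 1) : a * b = -(b * a) := by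
  simpa using IsSuperAffineHopfAlgebra.superComm 1 1 a b ha hb

theorem odd_sq (h2 : (2 : k) ≠ 0) {a : A} (ha : a ∈ 𝒜 1) : a * a = 0 := by
  have e := odd_anticomm 𝒜 ha ha
  rw [eq_neg_iff_add_eq_zero, ← two_smul k] at e
  exact (smul_eq_zero.1 e).resolve_left h2

theorem isAnticommuting_of_odd (h2 : (2 : k) ≠ 0) {ι : Type*} {y : ι → A}
    (hy : ∀ i, y i ∈ 𝒜 1) : IsAnticommuting y :=
  ⟨fun i => odd_sq 𝒜 h2 (hy i), fun i j => odd_anticomm 𝒜 (hy i) (hy j)⟩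

theorem odd_mul_comm {y : A} (hy : y ∈ 𝒜 1) (c : A) : y * c = parity 𝒜 c * y := by
  obtain ⟨a, ha, b, hb, rfl⟩ := even_add_odd 𝒜 c
  rw [map_add, parity_even 𝒜 ha, parity_odd 𝒜 hb, mul_add, add_mul, even_comm 𝒜 ha,
    odd_anticomm 𝒜 hy hb, neg_mul]

theorem evenPart_mem_sq {x : A} (hx : x ∈ superRadical 𝒜) : evenPart 𝒜 x ∈ superRadical 𝒜 ^ 2 := by
  induction hx using Submodule.span_induction with
  | mem x hx => rw [evenPart_of_odd 𝒜 hx]; exact Ideal.zero_mem _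
  | zero => rw [map_zero]; exact Ideal.zero_mem _
  | add x y _ _ hx hy => rw [map_add]; exact Ideal.add_mem _ hx hy
  | smul a x _ hx =>
    rw [smul_eq_mul, evenPart_mul]
    refine Ideal.add_mem _ (Ideal.mul_mem_left _ _ hx) ?_
    rw [Ideal.IsTwoSided.pow_succ, Submodule.pow_one]
    exact Ideal.mul_mem_mul (odd_mem 𝒜 (oddPart_mem 𝒜 a)) (odd_mem 𝒜 (oddPart_mem 𝒜 x))

theorem proj_odd {a : A} (ha : a ∈ 𝒜 1) : proj 𝒜 a = 0 :=
  Ideal.Quotient.eq_zero_iff_mem.2 (odd_mem 𝒜 ha)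

theorem coaction_apply (a : A) :
    coaction 𝒜 a = LinearMap.lTensor A (proj 𝒜).toLinearMap (Coalgebra.comul a) :=
  idTensorProj_of 𝒜 _

theorem mem_invariants {a : A} : a ∈ invariants 𝒜 ↔ coaction 𝒜 a = a ⊗ₜ 1 := Iff.rfl

theorem tensorPart_zero_le_ker : tensorPart 𝒜 0 ≤
    LinearMap.ker (TensorProduct.map (oddPart 𝒜) (proj 𝒜).toLinearMap) := by
  refine tensorPart_le_iff.2 fun p a ha b hb => ?_
  rw [LinearMap.mem_ker, TensorProduct.map_tmul]
  rcases eq_zero_or_one p with rfl | rfl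
  · rw [oddPart_of_even 𝒜 ha, TensorProduct.zero_tmul]
  · rw [AlgHom.toLinearMap_apply, proj_odd 𝒜 hb, TensorProduct.tmul_zero]

theorem tensorPart_one_le_ker : tensorPart 𝒜 1 ≤
    LinearMap.ker (TensorProduct.map (evenPart 𝒜) (proj 𝒜).toLinearMap) := by
  refine tensorPart_le_iff.2 fun p a ha b hb => ?_
  rw [LinearMap.mem_ker, TensorProduct.map_tmul]
  rcases eq_zero_or_one p with rfl | rfl
  · rw [AlgHom.toLinearMap_apply, proj_odd 𝒜 hb, TensorProduct.tmul_zero]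
  · rw [evenPart_of_odd 𝒜 ha, TensorProduct.zero_tmul]

theorem coaction_oddPart (a : A) : coaction 𝒜 (oddPart 𝒜 a) =
    LinearMap.rTensor (evenQuotient 𝒜) (oddPart 𝒜) (coaction 𝒜 a) := by
  have id_eq : (LinearMap.id : A →ₗ[k] A) = evenPart 𝒜 + oddPart 𝒜 :=
    LinearMap.ext fun a => (evenPart_add_oddPart 𝒜 a).symm
  have h0 := tensorPart_zero_le_ker 𝒜
    (IsSuperAffineHopfAlgebra.comul_mem 0 _ (evenPart_mem 𝒜 a))
  have h1 := tensorPart_one_le_ker 𝒜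
    (IsSuperAffineHopfAlgebra.comul_mem 1 _ (oddPart_mem 𝒜 a))
  rw [LinearMap.mem_ker] at h0 h1
  calc coaction 𝒜 (oddPart 𝒜 a)
      = TensorProduct.map (evenPart 𝒜 + oddPart 𝒜) (proj 𝒜).toLinearMap
          (Coalgebra.comul (oddPart 𝒜 a)) := by rw [coaction_apply, ← id_eq, LinearMap.lTensor]
    _ = TensorProduct.map (oddPart 𝒜) (proj 𝒜).toLinearMap
          (Coalgebra.comul (evenPart 𝒜 a + oddPart 𝒜 a)) := by
      rw [TensorProduct.map_add_left, LinearMap.add_apply, h1, zero_add, map_add, map_add, h0,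
        zero_add]
    _ = _ := by
      rw [evenPart_add_oddPart, coaction_apply]
      exact (LinearMap.congr_fun (LinearMap.rTensor_comp_lTensor ..) _).symm

theorem oddPart_mem_invariants {a : A} (ha : a ∈ invariants 𝒜) : oddPart 𝒜 a ∈ invariants 𝒜 := by
  rw [mem_invariants] at ha ⊢
  rw [coaction_oddPart, ha, LinearMap.rTensor_tmul]

theorem proj_surjective : Function.Surjective (proj 𝒜) := Ideal.Quotient.mk_surjective

/-- `B` is commutative, since only even elements of `A` survive in it. -/
abbrev evenQuotientCommRing : CommRing (evenQuotient 𝒜) where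
  mul_comm x y := by
    obtain ⟨a, rfl⟩ := proj_surjective 𝒜 x
    obtain ⟨b, rfl⟩ := proj_surjective 𝒜 y
    obtain ⟨a0, h0, a1, h1, rfl⟩ := even_add_odd 𝒜 a
    rw [map_add, proj_odd 𝒜 h1, add_zero, ← map_mul, ← map_mul, even_comm 𝒜 h0]

end SuperCommutative

attribute [local instance] evenQuotientCommRing

section SuperHopfAlgebra

open Coalgebra

variable {k A : Type*} [Field k] [Ring A] [Algebra k A] [Coalgebra k A]
variable (𝒜 : ZMod 2 → Submodule k A) [GradedAlgebra 𝒜] [IsSuperAffineHopfAlgebra 𝒜]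

/-- The counit of `A` as a homomorphism of algebras. -/
def counitHom : A →ₐ[k] k :=
  AlgHom.ofLinearMap counit (IsSuperAffineHopfAlgebra.counit_one 𝒜)
    (IsSuperAffineHopfAlgebra.counit_mul 𝒜)

theorem counitHom_odd {a : A} (ha : a ∈ 𝒜 1) : counitHom 𝒜 a = 0 :=
  IsSuperAffineHopfAlgebra.counit_odd a ha

theorem counitHom_parity (a : A) : counitHom 𝒜 (parity 𝒜 a) = counitHom 𝒜 a := by
  obtain ⟨b, hb, c, hc, rfl⟩ := even_add_odd 𝒜 a
  rw [map_add, parity_even 𝒜 hb, parity_odd 𝒜 hc, map_add, map_add, map_neg,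
    counitHom_odd 𝒜 hc, neg_zero]

theorem superRadical_le_ker_counitHom : superRadical 𝒜 ≤ RingHom.ker (counitHom 𝒜) :=
  Ideal.span_le.2 fun _ ha => counitHom_odd 𝒜 ha

theorem map_proj_proj_comul (a : A) :
    TensorProduct.map (proj 𝒜).toLinearMap (proj 𝒜).toLinearMap (comul a) =
      Algebra.TensorProduct.map (proj 𝒜) (AlgHom.id k (evenQuotient 𝒜)) (coaction 𝒜 a) := by
  rw [coaction_apply]
  exact (LinearMap.congr_fun (LinearMap.rTensor_comp_lTensor ..) _).symm

instance : ((superRadical 𝒜).restrictScalars k).IsCoideal where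
  counit_eq_zero _ ha := superRadical_le_ker_counitHom 𝒜 ha
  map_mkQ_comul_eq_zero a ha := by
    obtain ⟨t, ht⟩ := coaction_rad_mem 𝒜 ha
    have proj_comp_subtype :
        (proj 𝒜).toLinearMap ∘ₗ (superRadical 𝒜).subtype.restrictScalars k = 0 :=
      LinearMap.ext fun x => Ideal.Quotient.eq_zero_iff_mem.2 x.2
    refine (map_proj_proj_comul 𝒜 a).trans ?_
    rw [← ht]
    change LinearMap.rTensor _ (proj 𝒜).toLinearMap _ = 0
    rw [← LinearMap.comp_apply, ← LinearMap.rTensor_comp, proj_comp_subtype,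
      LinearMap.rTensor_zero, LinearMap.zero_apply]

instance : Coalgebra k (evenQuotient 𝒜) :=
  inferInstanceAs (Coalgebra k (A ⧸ (superRadical 𝒜).restrictScalars k))

theorem comul_proj (a : A) : comul (R := k) (proj 𝒜 a) =
    TensorProduct.map (proj 𝒜).toLinearMap (proj 𝒜).toLinearMap (comul a) := rfl

theorem counit_proj (a : A) : counit (R := k) (proj 𝒜 a) = counitHom 𝒜 a := rfl

instance : Bialgebra k (evenQuotient 𝒜) :=
  Bialgebra.mk' k (evenQuotient 𝒜)
    (by rw [← map_one (proj 𝒜), counit_proj, map_one])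
    (by
      intro x y
      obtain ⟨a, rfl⟩ := proj_surjective 𝒜 x
      obtain ⟨b, rfl⟩ := proj_surjective 𝒜 y
      simp only [← map_mul, counit_proj])
    (by rw [← map_one (proj 𝒜), comul_proj, map_proj_proj_comul, map_one, map_one])
    (by
      intro x y
      obtain ⟨a, rfl⟩ := proj_surjective 𝒜 x
      obtain ⟨b, rfl⟩ := proj_surjective 𝒜 y
      simp only [← map_mul, comul_proj, map_proj_proj_comul])

theorem exists_quotAntipode : ∃ S : evenQuotient 𝒜 →ₗ[k] evenQuotient 𝒜,
    LinearMap.mul' k _ ∘ₗ S.rTensor _ ∘ₗ comul = Algebra.linearMap k _ ∘ₗ counit ∧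
      LinearMap.mul' k _ ∘ₗ S.lTensor _ ∘ₗ comul = Algebra.linearMap k _ ∘ₗ counit := by
  obtain ⟨S, hS, hleft, hright⟩ := IsSuperAffineHopfAlgebra.exists_antipode (𝒜 := 𝒜)
  have hrad : superRadical 𝒜 ≤ RingHom.ker ((proj 𝒜).comp S) :=
    Ideal.span_le.2 fun a ha => proj_odd 𝒜 (hS 1 a ha)
  let T : evenQuotient 𝒜 →ₐ[k] evenQuotient 𝒜 :=
    Ideal.Quotient.liftₐ (superRadical 𝒜) ((proj 𝒜).comp S) hrad
  let p := (proj 𝒜).toLinearMap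
  have mul_left : p ∘ₗ LinearMap.mul' k A ∘ₗ TensorProduct.map S.toLinearMap LinearMap.id =
      LinearMap.mul' k _ ∘ₗ T.toLinearMap.rTensor _ ∘ₗ TensorProduct.map p p :=
    TensorProduct.ext' fun _ _ => rfl
  have mul_right : p ∘ₗ LinearMap.mul' k A ∘ₗ TensorProduct.map LinearMap.id S.toLinearMap =
      LinearMap.mul' k _ ∘ₗ T.toLinearMap.lTensor _ ∘ₗ TensorProduct.map p p :=
    TensorProduct.ext' fun _ _ => rfl
  refine ⟨T.toLinearMap, LinearMap.ext fun x => ?_, LinearMap.ext fun x => ?_⟩ <;>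
    obtain ⟨a, rfl⟩ := proj_surjective 𝒜 x
  · exact (LinearMap.congr_fun mul_left (comul a)).symm.trans
      congr(p $(LinearMap.congr_fun hleft a))
  · exact (LinearMap.congr_fun mul_right (comul a)).symm.trans
      congr(p $(LinearMap.congr_fun hright a))

instance : HopfAlgebra k (evenQuotient 𝒜) where
  antipode := (exists_quotAntipode 𝒜).choose
  mul_antipode_rTensor_comul := (exists_quotAntipode 𝒜).choose_spec.1
  mul_antipode_lTensor_comul := (exists_quotAntipode 𝒜).choose_spec.2

theorem isComodule_coaction : IsComodule (coaction 𝒜).toLinearMap := by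
  have coaction_eq : (coaction 𝒜).toLinearMap =
      (proj 𝒜).toLinearMap.lTensor A ∘ₗ comul := LinearMap.ext (coaction_apply 𝒜)
  rw [coaction_eq]
  exact IsComodule.of_coalgHom
    (Coalgebra.Quotient.mkQCoalgHom ((superRadical 𝒜).restrictScalars k))

end SuperHopfAlgebra

section PowerQuotients

variable {k A : Type*} [Field k] [Ring A] [Algebra k A] (𝒜 : ZMod 2 → Submodule k A)

/-- The inclusion of `J^n` into `A`. -/
abbrev powIncl (n : ℕ) : ↥(superRadical 𝒜 ^ n) →ₗ[k] A :=
  (superRadical 𝒜 ^ n).subtype.restrictScalars k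

/-- The inclusion of `J^(n+1)` into `J^n`. -/
def powSuccIncl (n : ℕ) : ↥(superRadical 𝒜 ^ (n + 1)) →ₗ[k] ↥(superRadical 𝒜 ^ n) :=
  (Submodule.inclusion (Ideal.pow_le_pow_right n.le_succ)).restrictScalars k

theorem powSuccIncl_injective (n : ℕ) : Function.Injective (powSuccIncl 𝒜 n) :=
  Submodule.inclusion_injective (Ideal.pow_le_pow_right n.le_succ)

theorem grMk_surjective (n : ℕ) : Function.Surjective (grMk 𝒜 n) := Submodule.mkQ_surjective _

theorem grMk_eq_zero {n : ℕ} {x : ↥(superRadical 𝒜 ^ n)} :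
    grMk 𝒜 n x = 0 ↔ (x : A) ∈ superRadical 𝒜 ^ (n + 1) :=
  Submodule.Quotient.mk_eq_zero _

theorem exact_powSuccIncl_grMk (n : ℕ) :
    Function.Exact (powSuccIncl 𝒜 n) ((grMk 𝒜 n).restrictScalars k) := fun _ =>
  (grMk_eq_zero 𝒜).trans ⟨fun hx => ⟨⟨_, hx⟩, rfl⟩, fun ⟨y, hy⟩ => hy ▸ y.2⟩

end PowerQuotients

section Graded

variable {k A : Type*} [Field k] [Ring A] [Algebra k A] [Coalgebra k A]
variable (𝒜 : ZMod 2 → Submodule k A) [GradedAlgebra 𝒜] [IsSuperAffineHopfAlgebra 𝒜]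

theorem proj_smul (n : ℕ) (a : A) (m : gr 𝒜 n) : proj 𝒜 a • m = a • m := rfl

instance (n : ℕ) : IsScalarTower k (evenQuotient 𝒜) (gr 𝒜 n) where
  smul_assoc c b m := by
    obtain ⟨a, rfl⟩ := proj_surjective 𝒜 b
    rw [← map_smul, proj_smul, proj_smul, smul_assoc]

theorem isComoduleHom_powIncl (n : ℕ) :
    IsComoduleHom (powCoaction 𝒜 n) (coaction 𝒜).toLinearMap (powIncl 𝒜 n) :=
  LinearMap.ext (powTensor_powCoaction 𝒜 n)

theorem isComoduleHom_powSuccIncl (n : ℕ) :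
    IsComoduleHom (powCoaction 𝒜 (n + 1)) (powCoaction 𝒜 n) (powSuccIncl 𝒜 n) := by
  refine LinearMap.ext fun x => powTensor_injective 𝒜 n ?_
  rw [LinearMap.comp_apply, LinearMap.comp_apply, powTensor_powCoaction, powTensor,
    ← LinearMap.comp_apply, ← LinearMap.rTensor_comp]
  exact powTensor_powCoaction 𝒜 (n + 1) x

theorem isComoduleHom_grMk (n : ℕ) :
    IsComoduleHom (powCoaction 𝒜 n) (grCoaction 𝒜 n) ((grMk 𝒜 n).restrictScalars k) :=
  rfl

theorem isComodule_powCoaction (n : ℕ) : IsComodule (powCoaction 𝒜 n) :=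
  (isComodule_coaction 𝒜).of_injective (isComoduleHom_powIncl 𝒜 n) Subtype.val_injective

theorem powCoaction_smul (n : ℕ) (a : A) (x : ↥(superRadical 𝒜 ^ n)) :
    powCoaction 𝒜 n (a • x) = tensorAct (coaction 𝒜 a) (powCoaction 𝒜 n x) := by
  apply powTensor_injective 𝒜 n
  rw [powTensor_powCoaction, powTensor, rTensor_tensorAct LinearMap.id _ fun _ _ => rfl,
    LinearMap.rTensor_id, LinearMap.id_apply, tensorAct_eq_mul, Submodule.coe_smul, smul_eq_mul,
    map_mul, ← powTensor_powCoaction, powTensor]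

theorem isHopfModule_gr (n : ℕ) : IsHopfModule (grCoaction 𝒜 n) where
  toIsComodule := (isComodule_powCoaction 𝒜 n).of_surjective (isComoduleHom_grMk 𝒜 n)
    (grMk_surjective 𝒜 n)
  map_smul b m := by
    obtain ⟨a, rfl⟩ := proj_surjective 𝒜 b
    obtain ⟨x, rfl⟩ := grMk_surjective 𝒜 n m
    have e := (isComoduleHom_grMk 𝒜 n).apply (a • x)
    rw [powCoaction_smul, rTensor_tensorAct (proj 𝒜).toLinearMap _ fun _ _ => rfl,
      (isComoduleHom_grMk 𝒜 n).apply] at e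
    rw [comul_proj, map_proj_proj_comul]
    exact e.symm

theorem isAcyclic_powCoaction {N : ℕ} (hN : superRadical 𝒜 ^ N = ⊥) (n : ℕ) :
    IsAcyclic (powCoaction 𝒜 n) := by
  obtain ⟨d, hd⟩ : ∃ d, N ≤ n + d := ⟨N, Nat.le_add_left N n⟩
  induction d generalizing n with
  | zero =>
    have hbot : superRadical 𝒜 ^ n = ⊥ := eq_bot_iff.2 (hN ▸ Ideal.pow_le_pow_right hd)
    have := Submodule.subsingleton_iff_eq_bot.2 hbot
    exact fun z _ => Subsingleton.elim 0 z ▸ Submodule.zero_mem _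
  | succ d ih =>
    exact IsAcyclic.of_exact (isComoduleHom_powSuccIncl 𝒜 n) (isComoduleHom_grMk 𝒜 n)
      (powSuccIncl_injective 𝒜 n) (exact_powSuccIncl_grMk 𝒜 n) (grMk_surjective 𝒜 n)
      (ih (n + 1) (by omega)) (isComodule_powCoaction 𝒜 n) (isHopfModule_gr 𝒜 n).isAcyclic

theorem mem_coinvariants_powCoaction {n : ℕ} {x : ↥(superRadical 𝒜 ^ n)} :
    x ∈ coinvariants (powCoaction 𝒜 n) ↔ (x : A) ∈ invariants 𝒜 := by
  rw [mem_coinvariants, mem_invariants, ← (powTensor_injective 𝒜 n).eq_iff, powTensor_powCoaction]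
  rfl

theorem grMk_mem_grInvariants {n : ℕ} {x : ↥(superRadical 𝒜 ^ n)} (hx : (x : A) ∈ invariants 𝒜) :
    grMk 𝒜 n x ∈ grInvariants 𝒜 n := by
  have e := (isComoduleHom_grMk 𝒜 n).apply x
  rw [mem_coinvariants.1 ((mem_coinvariants_powCoaction 𝒜).2 hx)] at e
  exact e.symm

theorem exists_invariant_of_mem_grInvariants {N : ℕ} (hN : superRadical 𝒜 ^ N = ⊥) {n : ℕ}
    {m : gr 𝒜 n} (hm : m ∈ grInvariants 𝒜 n) :
    ∃ x : ↥(superRadical 𝒜 ^ n), (x : A) ∈ invariants 𝒜 ∧ grMk 𝒜 n x = m := by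
  obtain ⟨x, hx, hxm⟩ := IsAcyclic.exists_mem_coinvariants (isComoduleHom_powSuccIncl 𝒜 n)
    (isComoduleHom_grMk 𝒜 n) (powSuccIncl_injective 𝒜 n) (exact_powSuccIncl_grMk 𝒜 n)
    (grMk_surjective 𝒜 n) (isAcyclic_powCoaction 𝒜 hN (n + 1)) (isComodule_powCoaction 𝒜 n) hm
  exact ⟨x, (mem_coinvariants_powCoaction 𝒜).1 hx, hxm⟩

theorem span_grMk_eq_top {n : ℕ} {ι : Type*} (z : ι → ↥(superRadical 𝒜 ^ n))
    (hz : superRadical 𝒜 ^ n ≤ Ideal.span (Set.range fun i => (z i : A))) :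
    Submodule.span (evenQuotient 𝒜) (Set.range fun i => grMk 𝒜 n (z i)) = ⊤ := by
  rw [eq_top_iff]
  rintro m -
  obtain ⟨x, rfl⟩ := grMk_surjective 𝒜 n m
  have hmap : (x : A) ∈ (Submodule.span A (Set.range z)).map (superRadical 𝒜 ^ n).subtype := by
    rw [Submodule.map_span, ← Set.range_comp]
    exact hz x.2
  obtain ⟨y, hy, hyx⟩ := hmap
  obtain rfl : y = x := Subtype.ext hyx
  induction hy using Submodule.span_induction with
  | mem y hy =>
    obtain ⟨i, rfl⟩ := hy
    exact Submodule.subset_span ⟨i, rfl⟩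
  | zero => rw [map_zero]; exact Submodule.zero_mem _
  | add y y' _ _ h h' =>
    rw [map_add]
    exact Submodule.add_mem _ (h rfl) (h' rfl)
  | smul a y _ h =>
    rw [map_smul, ← proj_smul]
    exact Submodule.smul_mem _ _ (h rfl)

theorem pow_le_sup_of_span_grMk_eq_top {n : ℕ} {ι : Type*} (z : ι → ↥(superRadical 𝒜 ^ n))
    (hz : Submodule.span (evenQuotient 𝒜) (Set.range fun i => grMk 𝒜 n (z i)) = ⊤) :
    superRadical 𝒜 ^ n ≤
      Ideal.span (Set.range fun i => (z i : A)) ⊔ superRadical 𝒜 ^ (n + 1) := by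
  intro x hx
  have exists_lift (m : gr 𝒜 n) : ∃ y : ↥(superRadical 𝒜 ^ n),
      (y : A) ∈ Ideal.span (Set.range fun i => (z i : A)) ∧ grMk 𝒜 n y = m := by
    have hm := hz.ge (Submodule.mem_top (x := m))
    induction hm using Submodule.span_induction with
    | mem m hm =>
      obtain ⟨i, rfl⟩ := hm
      exact ⟨z i, Ideal.subset_span ⟨i, rfl⟩, rfl⟩
    | zero => exact ⟨0, Ideal.zero_mem _, map_zero _⟩
    | add m m' _ _ h h' =>
      obtain ⟨y, hy, rfl⟩ := h
      obtain ⟨y', hy', rfl⟩ := h'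
      exact ⟨y + y', Ideal.add_mem _ hy hy', map_add _ _ _⟩
    | smul b m _ h =>
      obtain ⟨y, hy, rfl⟩ := h
      obtain ⟨a, rfl⟩ := proj_surjective 𝒜 b
      exact ⟨a • y, Ideal.mul_mem_left _ a hy, map_smul _ _ _⟩
  obtain ⟨y, hy, hyx⟩ := exists_lift (grMk 𝒜 n ⟨x, hx⟩)
  refine Submodule.mem_sup.2 ⟨y, hy, x - y, ?_, add_sub_cancel _ _⟩
  exact (grMk_eq_zero 𝒜 (x := ⟨x, hx⟩ - y)).1 (by rw [map_sub, hyx, sub_self])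

end Graded

section Basis

variable {K M ι : Type*} [Ring K] [AddCommGroup M] [Module K M] {W : Submodule K M}

theorem linearIndependent_coe_basis (b : Module.Basis ι K W) :
    LinearIndependent K fun i => (b i : M) :=
  b.linearIndependent.map' _ (Submodule.ker_subtype _)

theorem span_coe_basis (b : Module.Basis ι K W) :
    Submodule.span K (Set.range fun i => (b i : M)) = W := by
  have h := congr(Submodule.map W.subtype $(b.span_eq))
  rwa [Submodule.map_span, ← Set.range_comp, Submodule.map_top, Submodule.range_subtype] at h

end Basis

section Finiteness

variable {k A : Type*} [Field k] [Ring A] [Algebra k A] [Coalgebra k A]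
variable (𝒜 : ZMod 2 → Submodule k A) [GradedAlgebra 𝒜] [IsSuperAffineHopfAlgebra 𝒜]

theorem superRadical_le_span_oddPart {S : Set A} (hS : Algebra.adjoin k S = ⊤) :
    superRadical 𝒜 ≤ Ideal.span (oddPart 𝒜 '' S) := by
  have oddPart_mem_span (a : A) : oddPart 𝒜 a ∈ Ideal.span (oddPart 𝒜 '' S) := by
    have ha : a ∈ Algebra.adjoin k S := hS ▸ Algebra.mem_top
    induction ha using Algebra.adjoin_induction with
    | mem x hx => exact Ideal.subset_span ⟨x, hx, rfl⟩
    | algebraMap r =>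
      rw [oddPart_of_even 𝒜 (SetLike.algebraMap_mem_graded 𝒜 r)]
      exact Ideal.zero_mem _
    | add x y _ _ hx hy => rw [map_add]; exact Ideal.add_mem _ hx hy
    | mul x y _ _ hx hy =>
      rw [oddPart_mul, ← even_comm 𝒜 (evenPart_mem 𝒜 y)]
      exact Ideal.add_mem _ (Ideal.mul_mem_left _ _ hy) (Ideal.mul_mem_left _ _ hx)
  exact Ideal.span_le.2 fun x hx => oddPart_of_odd 𝒜 hx ▸ oddPart_mem_span x

theorem exists_odd_generators : ∃ (m : ℕ) (y : Fin m → A), (∀ i, y i ∈ 𝒜 1) ∧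
    superRadical 𝒜 ≤ Ideal.span (Set.range y) := by
  obtain ⟨S, hS⟩ := (IsSuperAffineHopfAlgebra.finiteType (𝒜 := 𝒜)).out
  obtain ⟨m, y, -, hy⟩ := (S.finite_toSet.image (oddPart 𝒜)).fin_param
  refine ⟨m, y, fun i => ?_, hy ▸ superRadical_le_span_oddPart 𝒜 hS⟩
  obtain ⟨a, -, ha⟩ := hy.le ⟨i, rfl⟩
  exact ha ▸ oddPart_mem 𝒜 a

theorem exists_superRadical_pow_eq_bot (h2 : (2 : k) ≠ 0) : ∃ N, superRadical 𝒜 ^ N = ⊥ := by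
  obtain ⟨m, y, hy, hJ⟩ := exists_odd_generators 𝒜
  exact ⟨m + 1, (isAnticommuting_of_odd 𝒜 h2 hy).pow_eq_bot
    (fun i c => ⟨_, odd_mul_comm 𝒜 (hy i) c⟩) hJ (by simp)⟩

instance : Nontrivial (evenQuotient 𝒜) :=
  (Bialgebra.counitAlgHom k (evenQuotient 𝒜)).toRingHom.domain_nontrivial

theorem finite_gr_one : Module.Finite (evenQuotient 𝒜) (gr 𝒜 1) := by
  obtain ⟨m, y, hy, hJ⟩ := exists_odd_generators 𝒜
  exact ⟨Submodule.fg_def.2 ⟨_, Set.finite_range _, span_grMk_eq_top 𝒜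
    (fun i => ⟨y i, odd_mem_pow_one 𝒜 (hy i)⟩) ((Submodule.pow_one _).le.trans hJ)⟩⟩

theorem finite_grInvariants_one : Module.Finite k (grInvariants 𝒜 1) := by
  have := finite_gr_one 𝒜
  let b := Module.Basis.ofVectorSpace k (grInvariants 𝒜 1)
  have := ((isHopfModule_gr 𝒜 1).linearIndependent (fun i => (b i).2)
    (linearIndependent_coe_basis b)).finite
  exact Module.Finite.of_basis b

end Finiteness

section OddClass

variable {k A : Type*} [Field k] [Ring A] [Algebra k A] [Coalgebra k A]
variable (𝒜 : ZMod 2 → Submodule k A) [GradedAlgebra 𝒜] [IsSuperAffineHopfAlgebra 𝒜]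

/-- The class in `J / J^2` of the odd part of an element of `A`. -/
def oddClass : A →ₗ[k] gr 𝒜 1 where
  toFun a := grMk 𝒜 1 ⟨oddPart 𝒜 a, odd_mem_pow_one 𝒜 (oddPart_mem 𝒜 a)⟩
  map_add' a b := congrArg (grMk 𝒜 1) (Subtype.ext (map_add (oddPart 𝒜) a b))
  map_smul' c a := congrArg (grMk 𝒜 1) (Subtype.ext (map_smul (oddPart 𝒜) c a))

variable {𝒜}

theorem oddClass_of_odd {a : A} (ha : a ∈ 𝒜 1) :
    oddClass 𝒜 a = grMk 𝒜 1 ⟨a, odd_mem_pow_one 𝒜 ha⟩ :=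
  congrArg (grMk 𝒜 1) (Subtype.ext (oddPart_of_odd 𝒜 ha))

theorem oddClass_of_even {a : A} (ha : a ∈ 𝒜 0) : oddClass 𝒜 a = 0 :=
  (grMk_eq_zero 𝒜).2 ((oddPart_of_even 𝒜 ha).symm ▸ Ideal.zero_mem _ : oddPart 𝒜 a ∈ _)

theorem oddClass_coe (x : ↥(superRadical 𝒜 ^ 1)) : oddClass 𝒜 (x : A) = grMk 𝒜 1 x := by
  rw [eq_comm, ← sub_eq_zero]
  refine (map_sub (grMk 𝒜 1) _ _).symm.trans ((grMk_eq_zero 𝒜).2 ?_)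
  change (x : A) - oddPart 𝒜 (x : A) ∈ superRadical 𝒜 ^ 2
  rw [← eq_sub_of_add_eq (evenPart_add_oddPart 𝒜 (x : A))]
  exact evenPart_mem_sq 𝒜 ((Submodule.pow_one (superRadical 𝒜)).le x.2)

theorem proj_evenPart (a : A) : proj 𝒜 (evenPart 𝒜 a) = proj 𝒜 a := by
  conv_rhs => rw [← evenPart_add_oddPart 𝒜 a, map_add, proj_odd 𝒜 (oddPart_mem 𝒜 a), add_zero]

theorem oddClass_mul (a b : A) :
    oddClass 𝒜 (a * b) = proj 𝒜 a • oddClass 𝒜 b + proj 𝒜 b • oddClass 𝒜 a := by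
  rw [← proj_evenPart a, ← proj_evenPart b]
  refine congrArg (grMk 𝒜 1) (Subtype.ext ((oddPart_mul 𝒜 a b).trans ?_))
  rw [← even_comm 𝒜 (evenPart_mem 𝒜 b)]
  rfl

variable (𝒜) in
theorem exists_isOddCoordinates (h2 : (2 : k) ≠ 0) :
    ∃ (r : ℕ) (θ : Fin r → A), IsOddCoordinates 𝒜 θ := by
  obtain ⟨N, hN⟩ := exists_superRadical_pow_eq_bot 𝒜 h2
  have := finite_grInvariants_one 𝒜
  let b := Module.finBasis k (grInvariants 𝒜 1)
  choose x hx hxb using fun i => exists_invariant_of_mem_grInvariants 𝒜 hN (b i).2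
  have grMk_oddPart (i) : grMk 𝒜 1 ⟨oddPart 𝒜 (x i), odd_mem_pow_one 𝒜 (oddPart_mem 𝒜 (x i))⟩ =
      b i := (oddClass_coe (x i)).trans (hxb i)
  refine ⟨_, fun i => oddPart 𝒜 (x i), fun i => oddPart_mem 𝒜 _,
    fun i => oddPart_mem_invariants 𝒜 (hx i), ?_, ?_⟩
  · simp only [grMk_oddPart]
    exact linearIndependent_coe_basis b
  · simp only [grMk_oddPart]
    exact span_coe_basis b

end OddClass

section SuperTensor

open GradedTensorProduct

variable {k A : Type*} [Field k] [Ring A] [Algebra k A]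
variable (𝒜 : ZMod 2 → Submodule k A) [GradedAlgebra 𝒜]

/-- The contraction `a ⊗ b ↦ δ b • parity a` of the second factor. -/
def contract (δ : A →ₗ[k] k) : A ⊗[k] A →ₗ[k] A :=
  (TensorProduct.rid k A).toLinearMap ∘ₗ TensorProduct.map (parity 𝒜) δ

theorem contract_tmul (δ : A →ₗ[k] k) (a b : A) :
    contract 𝒜 δ (a ⊗ₜ b) = δ b • parity 𝒜 a := rfl

theorem of_tmul_mul_of_even (a c d : A) {b : A} (hb : b ∈ 𝒜 0) :
    of k 𝒜 𝒜 (a ⊗ₜ b) * of k 𝒜 𝒜 (c ⊗ₜ d) = of k 𝒜 𝒜 ((a * c) ⊗ₜ (b * d)) := by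
  obtain ⟨c0, h0, c1, h1, rfl⟩ := exists_even_add_odd 𝒜 c
  have e0 : of k 𝒜 𝒜 (a ⊗ₜ b) * of k 𝒜 𝒜 (c0 ⊗ₜ d) = of k 𝒜 𝒜 ((a * c0) ⊗ₜ (b * d)) :=
    tmul_zero_coe_mul_coe_tmul 𝒜 𝒜 a ⟨b, hb⟩ ⟨c0, h0⟩ d
  have e1 : of k 𝒜 𝒜 (a ⊗ₜ b) * of k 𝒜 𝒜 (c1 ⊗ₜ d) = of k 𝒜 𝒜 ((a * c1) ⊗ₜ (b * d)) :=
    tmul_zero_coe_mul_coe_tmul 𝒜 𝒜 a ⟨b, hb⟩ ⟨c1, h1⟩ d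
  rw [TensorProduct.add_tmul, map_add, mul_add, e0, e1, mul_add, TensorProduct.add_tmul, map_add]

theorem of_tmul_mul_of_odd (a c d : A) {b : A} (hb : b ∈ 𝒜 1) :
    of k 𝒜 𝒜 (a ⊗ₜ b) * of k 𝒜 𝒜 (c ⊗ₜ d) = of k 𝒜 𝒜 ((a * parity 𝒜 c) ⊗ₜ (b * d)) := by
  obtain ⟨c0, h0, c1, h1, rfl⟩ := exists_even_add_odd 𝒜 c
  have e0 : of k 𝒜 𝒜 (a ⊗ₜ b) * of k 𝒜 𝒜 (c0 ⊗ₜ d) = of k 𝒜 𝒜 ((a * c0) ⊗ₜ (b * d)) :=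
    tmul_coe_mul_zero_coe_tmul 𝒜 𝒜 a ⟨b, hb⟩ ⟨c0, h0⟩ d
  have e1 : of k 𝒜 𝒜 (a ⊗ₜ b) * of k 𝒜 𝒜 (c1 ⊗ₜ d) = -of k 𝒜 𝒜 ((a * c1) ⊗ₜ (b * d)) := by
    refine (tmul_coe_mul_coe_tmul 𝒜 𝒜 a ⟨b, hb⟩ ⟨c1, h1⟩ d).trans ?_
    rw [mul_one, uzpow_one, Units.neg_smul, one_smul]
  rw [TensorProduct.add_tmul, map_add, mul_add, e0, e1, map_add, parity_even 𝒜 h0,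
    parity_odd 𝒜 h1, mul_add, TensorProduct.add_tmul, map_add, mul_neg, TensorProduct.neg_tmul,
    map_neg]

end SuperTensor

section PointDerivation

open Coalgebra GradedTensorProduct

variable {k A : Type*} [Field k] [Ring A] [Algebra k A] [Coalgebra k A]
variable (𝒜 : ZMod 2 → Submodule k A) [GradedAlgebra 𝒜] [IsSuperAffineHopfAlgebra 𝒜]

/-- The odd `k`-derivations of `A` at the counit. -/
structure IsOddPointDerivation (δ : A →ₗ[k] k) : Prop where
  even : ∀ a ∈ 𝒜 0, δ a = 0
  mul : ∀ a b, δ (a * b) = δ a * counitHom 𝒜 b + counitHom 𝒜 a * δ b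

theorem counitHom_comp_contract (δ : A →ₗ[k] k) :
    (counitHom 𝒜).toLinearMap ∘ₗ contract 𝒜 δ =
      δ ∘ₗ (TensorProduct.lid k A).toLinearMap ∘ₗ counit.rTensor A :=
  TensorProduct.ext' fun a b => by
    rw [LinearMap.comp_apply, AlgHom.toLinearMap_apply, contract_tmul, map_smul, counitHom_parity,
      smul_eq_mul, mul_comm]
    exact (map_smul δ (counitHom 𝒜 a) b).symm

theorem comul_comp_contract (δ : A →ₗ[k] k) :
    comul ∘ₗ contract 𝒜 δ = TensorProduct.map (parity 𝒜) (contract 𝒜 δ) ∘ₗ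
      (TensorProduct.assoc k A A A).toLinearMap ∘ₗ comul.rTensor A := by
  refine TensorProduct.ext' fun a b => ?_
  have smul_map_parity : δ b • TensorProduct.map (parity 𝒜) (parity 𝒜) =
      TensorProduct.map (parity 𝒜) (contract 𝒜 δ) ∘ₗ
        (TensorProduct.assoc k A A A).toLinearMap ∘ₗ (TensorProduct.mk k (A ⊗[k] A) A).flip b :=
    TensorProduct.ext' fun c d => (TensorProduct.tmul_smul _ _ _).symm
  rw [LinearMap.comp_apply, contract_tmul, map_smul, comul_parity]
  exact LinearMap.congr_fun smul_map_parity (comul a)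

/-- The left-invariant superderivation with value `δ` at the counit. -/
def invariantDerivation (δ : A →ₗ[k] k) : Module.End k A := contract 𝒜 δ ∘ₗ comul

theorem counitHom_invariantDerivation (δ : A →ₗ[k] k) (a : A) :
    counitHom 𝒜 (invariantDerivation 𝒜 δ a) = δ a := by
  refine (LinearMap.congr_fun (counitHom_comp_contract 𝒜 δ) (comul a)).trans ?_
  rw [LinearMap.comp_apply, LinearMap.comp_apply, rTensor_counit_comul, LinearEquiv.coe_coe,
    TensorProduct.lid_tmul, one_smul]

theorem comul_comp_invariantDerivation (δ : A →ₗ[k] k) :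
    comul ∘ₗ invariantDerivation 𝒜 δ =
      TensorProduct.map (parity 𝒜) (invariantDerivation 𝒜 δ) ∘ₗ comul := by
  rw [invariantDerivation, ← LinearMap.comp_assoc, comul_comp_contract, LinearMap.comp_assoc,
    LinearMap.comp_assoc, Coalgebra.coassoc, ← LinearMap.comp_assoc, LinearMap.map_comp_lTensor]

namespace IsOddPointDerivation

variable {𝒜} {δ : A →ₗ[k] k} (hδ : IsOddPointDerivation 𝒜 δ)
include hδ

theorem contract_mem {i : ZMod 2} {z : A ⊗[k] A} (hz : z ∈ tensorPart 𝒜 i) :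
    contract 𝒜 δ z ∈ 𝒜 (i + 1) := by
  suffices h : tensorPart 𝒜 i ≤ (𝒜 (i + 1)).comap (contract 𝒜 δ) from h hz
  refine tensorPart_le_iff.2 fun p a ha b hb => ?_
  rw [Submodule.mem_comap, contract_tmul]
  rcases eq_or_ne p i with rfl | hp
  · rw [sub_self] at hb
    rw [hδ.even b hb, zero_smul]
    exact Submodule.zero_mem _
  · obtain rfl : p = i + 1 := (by decide : ∀ p i : ZMod 2, p ≠ i → p = i + 1) p i hp
    exact Submodule.smul_mem _ _ (parity_mem 𝒜 ha)

theorem contract_mul (x y : A ⊗[k] A) :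
    contract 𝒜 δ ((of k 𝒜 𝒜).symm (of k 𝒜 𝒜 x * of k 𝒜 𝒜 y)) =
      contract 𝒜 δ x * TensorProduct.rid k A (counit.lTensor A y) +
        parity 𝒜 (TensorProduct.rid k A (counit.lTensor A x)) * contract 𝒜 δ y := by
  induction x with
  | zero => simp
  | add x x' hx hx' =>
    simp only [map_add, add_mul, hx, hx']
    abel
  | tmul a b =>
    induction y with
    | zero => simp
    | add y y' hy hy' =>
      simp only [map_add, mul_add, hy, hy']
      abel
    | tmul c d =>
      have hε (x : A) : counit (R := k) x = counitHom 𝒜 x := rfl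
      obtain ⟨b0, h0, b1, h1, rfl⟩ := even_add_odd 𝒜 b
      rw [TensorProduct.tmul_add, map_add, add_mul, of_tmul_mul_of_even 𝒜 a c d h0,
        of_tmul_mul_of_odd 𝒜 a c d h1, ← map_add, of_symm_of]
      simp only [map_add, contract_tmul, LinearMap.lTensor_tmul, TensorProduct.rid_tmul, hε,
        hδ.mul, hδ.even b0 h0, counitHom_odd 𝒜 h1, parity_mul, parity_parity]
      simp only [zero_mul, zero_add, add_zero, zero_smul, map_zero, map_smul, smul_mul_assoc,
        mul_smul_comm]
      module

theorem invariantDerivation_mul (a b : A) : invariantDerivation 𝒜 δ (a * b) =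
    invariantDerivation 𝒜 δ a * b + parity 𝒜 a * invariantDerivation 𝒜 δ b := by
  have comul_mul : comul (R := k) (a * b) =
      (of k 𝒜 𝒜).symm (of k 𝒜 𝒜 (comul a) * of k 𝒜 𝒜 (comul b)) :=
    (LinearEquiv.eq_symm_apply _).2 (IsSuperAffineHopfAlgebra.comul_mul a b)
  simp only [invariantDerivation, LinearMap.comp_apply]
  rw [comul_mul, hδ.contract_mul, lTensor_counit_comul, lTensor_counit_comul,
    TensorProduct.rid_tmul, TensorProduct.rid_tmul, one_smul, one_smul]

theorem invariantDerivation_mem_lieAlg : invariantDerivation 𝒜 δ ∈ lieAlg 𝒜 1 := by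
  have hp : parity 𝒜 ^ (1 : ZMod 2).val = parity 𝒜 := pow_one _
  refine ⟨fun i a ha => hδ.contract_mem (IsSuperAffineHopfAlgebra.comul_mem i a ha), ?_, ?_⟩
  · rw [hp]
    exact hδ.invariantDerivation_mul
  · rw [hp]
    exact comul_comp_invariantDerivation 𝒜 δ

end IsOddPointDerivation

variable {𝒜}

theorem isOddPointDerivation_oddClass (f : gr 𝒜 1 →ₗ[evenQuotient 𝒜] evenQuotient 𝒜) :
    IsOddPointDerivation 𝒜 (counit ∘ₗ f.restrictScalars k ∘ₗ oddClass 𝒜) where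
  even a ha := by simp [oddClass_of_even ha]
  mul a b := by
    simp only [LinearMap.comp_apply, LinearMap.restrictScalars_apply, oddClass_mul, map_add,
      map_smul, smul_eq_mul, Bialgebra.counit_mul, counit_proj]
    ring

theorem counitHom_apply_of_even {D : Module.End k A} (hD : D ∈ lieAlg 𝒜 1) {a : A}
    (ha : a ∈ 𝒜 0) : counitHom 𝒜 (D a) = 0 :=
  counitHom_odd 𝒜 (hD.1 0 a ha)

theorem eq_zero_of_counitHom_apply_eq_zero {D : Module.End k A} (hD : D ∈ lieAlg 𝒜 1)
    (h : ∀ a, counitHom 𝒜 (D a) = 0) : D = 0 := by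
  have counit_comp : counit ∘ₗ D = (0 : A →ₗ[k] k) := LinearMap.ext h
  have h0 : counit.lTensor A ∘ₗ comul ∘ₗ D = 0 := by
    rw [hD.2.2, ← LinearMap.comp_assoc, LinearMap.lTensor_comp_map, counit_comp,
      TensorProduct.map_zero_right, LinearMap.zero_comp]
  ext a
  have e := congr(TensorProduct.rid k A ($h0 a))
  rwa [LinearMap.comp_apply, LinearMap.comp_apply, lTensor_counit_comul, TensorProduct.rid_tmul,
    one_smul, LinearMap.zero_apply, map_zero] at e

end PointDerivation

namespace IsOddCoordinates

variable {k A : Type*} [Field k] [Ring A] [Algebra k A] [Coalgebra k A]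
variable {𝒜 : ZMod 2 → Submodule k A} [GradedAlgebra 𝒜] [IsSuperAffineHopfAlgebra 𝒜]
variable {s : ℕ} {θ : Fin s → A} (hθ : IsOddCoordinates 𝒜 θ)
include hθ

/-- The `B`-basis of `J / J^2` given by odd coordinates. -/
def grOneBasis : Module.Basis (Fin s) (evenQuotient 𝒜) (gr 𝒜 1) :=
  Module.Basis.mk (v := fun i => grMk 𝒜 1 ⟨θ i, odd_mem_pow_one 𝒜 (hθ.odd i)⟩)
    ((isHopfModule_gr 𝒜 1).linearIndependent
      (fun i => grMk_mem_grInvariants 𝒜 (hθ.invariant i)) hθ.linearIndependent)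
    (by
      rw [← (isHopfModule_gr 𝒜 1).span_coinvariants, Submodule.span_le]
      exact hθ.span_eq.ge.trans (Submodule.span_le_restrictScalars k _ _))

theorem grOneBasis_apply (i : Fin s) :
    hθ.grOneBasis i = grMk 𝒜 1 ⟨θ i, odd_mem_pow_one 𝒜 (hθ.odd i)⟩ :=
  Module.Basis.mk_apply _ _ i

theorem superRadical_le_span (h2 : (2 : k) ≠ 0) :
    superRadical 𝒜 ≤ Ideal.span (Set.range θ) := by
  obtain ⟨N, hN⟩ := exists_superRadical_pow_eq_bot 𝒜 h2
  have hspan := hθ.grOneBasis.span_eq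
  rw [funext hθ.grOneBasis_apply] at hspan
  have hle := pow_le_sup_of_span_grMk_eq_top 𝒜
    (fun i => ⟨θ i, odd_mem_pow_one 𝒜 (hθ.odd i)⟩) hspan
  exact le_of_le_sup_pow_two hN ((Submodule.pow_one (superRadical 𝒜)).ge.trans hle)

theorem exists_dual (i : Fin s) :
    ∃ D ∈ lieAlg 𝒜 1, ∀ j, counitHom 𝒜 (D (θ j)) = (Pi.single i 1 : Fin s → k) j := by
  refine ⟨_, (isOddPointDerivation_oddClass
    (hθ.grOneBasis.coord i)).invariantDerivation_mem_lieAlg, fun j => ?_⟩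
  rw [counitHom_invariantDerivation, LinearMap.comp_apply, LinearMap.comp_apply,
    LinearMap.restrictScalars_apply, oddClass_of_odd (hθ.odd j), ← hθ.grOneBasis_apply,
    Module.Basis.coord_apply, Module.Basis.repr_self, Finsupp.single_apply, Pi.single_apply]
  split_ifs
  · exact Bialgebra.counit_one
  · exact map_zero _

end IsOddCoordinates

section EvalLie

variable {k A : Type*} [Field k] [Ring A] [Algebra k A] [Coalgebra k A]
variable {𝒜 : ZMod 2 → Submodule k A} [GradedAlgebra 𝒜] [IsSuperAffineHopfAlgebra 𝒜]

variable (𝒜) in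
/-- The values at the counit of the derivatives of the coordinates. -/
def evalLie {ι : Type*} (θ : ι → A) : lieAlg 𝒜 1 →ₗ[k] (ι → k) :=
  LinearMap.pi fun i =>
    (counitHom 𝒜).toLinearMap ∘ₗ LinearMap.applyₗ (θ i) ∘ₗ (lieAlg 𝒜 1).subtype

namespace IsOddCoordinates

variable {s : ℕ} {θ : Fin s → A} (hθ : IsOddCoordinates 𝒜 θ)
include hθ

theorem evalLie_injective (h2 : (2 : k) ≠ 0) : Function.Injective (evalLie 𝒜 θ) := by
  rw [injective_iff_map_eq_zero]
  rintro ⟨D, hD⟩ h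
  have counitHom_apply_of_mem (x : A) (hx : x ∈ Ideal.span (Set.range θ)) :
      counitHom 𝒜 (D x) = 0 := by
    induction hx using Submodule.span_induction with
    | mem x hx =>
      obtain ⟨i, rfl⟩ := hx
      exact congr_fun h i
    | zero => rw [map_zero, map_zero]
    | add x y _ _ hx hy => rw [map_add, map_add, hx, hy, add_zero]
    | smul c x hx' hx =>
      have hx0 : counitHom 𝒜 x = 0 := superRadical_le_ker_counitHom 𝒜
        (Ideal.span_le.2 (Set.range_subset_iff.2 fun i => odd_mem 𝒜 (hθ.odd i)) hx')
      rw [smul_eq_mul, hD.2.1, map_add, map_mul, map_mul, hx, hx0, mul_zero, mul_zero, add_zero]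
  refine Subtype.ext (eq_zero_of_counitHom_apply_eq_zero hD fun a => ?_)
  obtain ⟨a, ha, b, hb, rfl⟩ := even_add_odd 𝒜 a
  rw [map_add, map_add, counitHom_apply_of_even hD ha, zero_add]
  exact counitHom_apply_of_mem b (hθ.superRadical_le_span h2 (odd_mem 𝒜 hb))

theorem evalLie_surjective : Function.Surjective (evalLie 𝒜 θ) := by
  intro c
  choose D hD hDθ using hθ.exists_dual
  have evalLie_dual (i) : evalLie 𝒜 θ ⟨D i, hD i⟩ = Pi.single i 1 := funext (hDθ i)
  refine ⟨∑ i, c i • ⟨D i, hD i⟩, ?_⟩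
  simp only [map_sum, map_smul, evalLie_dual]
  exact (pi_eq_sum_univ' c).symm

theorem finite_lieAlg (h2 : (2 : k) ≠ 0) : Module.Finite k (lieAlg 𝒜 1) :=
  Module.Finite.of_injective _ (hθ.evalLie_injective h2)

theorem finrank_lieAlg (h2 : (2 : k) ≠ 0) : Module.finrank k (lieAlg 𝒜 1) = s := by
  rw [(LinearEquiv.ofBijective _ ⟨hθ.evalLie_injective h2, hθ.evalLie_surjective⟩).finrank_eq,
    Module.finrank_fin_fun]

end IsOddCoordinates

end EvalLie

namespace IsOddCoordinates

variable {k A : Type*} [Field k] [Ring A] [Algebra k A] [Coalgebra k A]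
variable {𝒜 : ZMod 2 → Submodule k A} [GradedAlgebra 𝒜] [IsSuperAffineHopfAlgebra 𝒜]
variable {s : ℕ} {θ : Fin s → A} (hθ : IsOddCoordinates 𝒜 θ)
include hθ

theorem mem_ker_counitHom (i : Fin s) : θ i ∈ RingHom.ker (counitHom 𝒜) :=
  counitHom_odd 𝒜 (hθ.odd i)

theorem list_prod_notMem_ker_counitHom_pow (l : List (Fin s)) (hl : l.Nodup) :
    (l.map θ).prod ∉ RingHom.ker (counitHom 𝒜) ^ (l.length + 1) := by
  have parity_mem_ker : ∀ a ∈ RingHom.ker (counitHom 𝒜), parity 𝒜 a ∈ RingHom.ker (counitHom 𝒜) :=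
    fun a ha => (counitHom_parity 𝒜 a).trans ha
  refine list_prod_notMem_pow_of_dual (RingHom.ker_ne_top _) parity_mem_ker
    hθ.mem_ker_counitHom (fun i => ?_) hl
  obtain ⟨D, hD, hDθ⟩ := hθ.exists_dual i
  refine ⟨D.toAddMonoidHom, hD.2.1, ?_, fun j hj => (hDθ j).trans (Pi.single_eq_of_ne hj 1)⟩
  rw [RingHom.mem_ker, map_sub, map_one, sub_eq_zero]
  exact (hDθ i).trans (Pi.single_eq_same i 1)

theorem monomial_coeff_eq_zero (h2 : (2 : k) ≠ 0) {κ : Type*} [Fintype κ] {f : κ → Finset (Fin s)}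
    (hf : Function.Injective f) {n : ℕ} {c : κ → k}
    (hc : ∑ b, c b • monomial θ (f b) ∈ superRadical 𝒜 ^ (n + 1)) {a : κ}
    (ha : (f a).card ≤ n) : c a = 0 :=
  (isAnticommuting_of_odd 𝒜 h2 hθ.odd).coeff_eq_zero hθ.mem_ker_counitHom
    hθ.list_prod_notMem_ker_counitHom_pow hf
    (Ideal.pow_right_mono (superRadical_le_ker_counitHom 𝒜) _ hc) ha

theorem linearIndependent_monomial (h2 : (2 : k) ≠ 0) : LinearIndependent k (monomial θ) :=
  Fintype.linearIndependent_iff.2 fun _ hc _ =>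
    hθ.monomial_coeff_eq_zero h2 (f := id) Function.injective_id (hc ▸ Ideal.zero_mem _) le_rfl

theorem monomial_mem_invariants (I : Finset (Fin s)) : monomial θ I ∈ invariants 𝒜 :=
  Subalgebra.list_prod_mem _ (List.forall_mem_map.2 fun i _ => hθ.invariant i)

/-- The monomials of degree `n`, as elements of `J^n`. -/
def powMonomial (n : ℕ) (I : {I : Finset (Fin s) // I.card = n}) : ↥(superRadical 𝒜 ^ n) :=
  ⟨monomial θ I, (congrArg (superRadical 𝒜 ^ ·) I.2).le
    (monomial_mem_pow (fun i => odd_mem 𝒜 (hθ.odd i)) I)⟩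

/-- The classes in `J^n / J^(n+1)` of the monomials of degree `n`. -/
def grMonomial (n : ℕ) (I : {I : Finset (Fin s) // I.card = n}) : gr 𝒜 n :=
  grMk 𝒜 n (hθ.powMonomial n I)

theorem grMonomial_mem_grInvariants (n : ℕ) (I : {I : Finset (Fin s) // I.card = n}) :
    hθ.grMonomial n I ∈ grInvariants 𝒜 n :=
  grMk_mem_grInvariants 𝒜 (hθ.monomial_mem_invariants I)

theorem sum_grMonomial {n : ℕ} (c : {I : Finset (Fin s) // I.card = n} → k) :
    ∑ I, c I • hθ.grMonomial n I = grMk 𝒜 n (∑ I, c I • hθ.powMonomial n I) :=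
  (map_sum ((grMk 𝒜 n).restrictScalars k) _ _).symm

theorem coe_sum_powMonomial {n : ℕ} (c : {I : Finset (Fin s) // I.card = n} → k) :
    ((∑ I, c I • hθ.powMonomial n I : ↥(superRadical 𝒜 ^ n)) : A) = ∑ I, c I • monomial θ I :=
  map_sum (((superRadical 𝒜 ^ n).subtype).restrictScalars k) _ _

theorem linearIndependent_grMonomial (h2 : (2 : k) ≠ 0) (n : ℕ) :
    LinearIndependent k (hθ.grMonomial n) := by
  refine Fintype.linearIndependent_iff.2 fun c hc I => ?_
  rw [hθ.sum_grMonomial, grMk_eq_zero, hθ.coe_sum_powMonomial] at hc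
  exact hθ.monomial_coeff_eq_zero h2 Subtype.val_injective hc I.2.le

theorem span_grMonomial (h2 : (2 : k) ≠ 0) (n : ℕ) :
    Submodule.span (evenQuotient 𝒜) (Set.range (hθ.grMonomial n)) = ⊤ := by
  refine span_grMk_eq_top 𝒜 (hθ.powMonomial n) ?_
  refine ((isAnticommuting_of_odd 𝒜 h2 hθ.odd).pow_le_span_monomial
    (fun i c => ⟨_, odd_mul_comm 𝒜 (hθ.odd i) c⟩) (hθ.superRadical_le_span h2) n).trans
    (Ideal.span_mono ?_)
  rintro _ ⟨I, hI, rfl⟩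
  exact ⟨⟨I, hI⟩, rfl⟩

/-- The `B`-basis of `J^n / J^(n+1)` given by the monomials of degree `n`. -/
def grBasis (h2 : (2 : k) ≠ 0) (n : ℕ) :
    Module.Basis {I : Finset (Fin s) // I.card = n} (evenQuotient 𝒜) (gr 𝒜 n) :=
  Module.Basis.mk ((isHopfModule_gr 𝒜 n).linearIndependent (hθ.grMonomial_mem_grInvariants n)
    (hθ.linearIndependent_grMonomial h2 n)) (hθ.span_grMonomial h2 n).ge

theorem exists_sub_mem_pow_succ (h2 : (2 : k) ≠ 0) {n : ℕ} {a : A} (ha : a ∈ invariants 𝒜)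
    (hn : a ∈ superRadical 𝒜 ^ n) : ∃ x ∈ Submodule.span k (Set.range (monomial θ)),
      a - x ∈ superRadical 𝒜 ^ (n + 1) := by
  have mem_span_grMonomial : grMk 𝒜 n ⟨a, hn⟩ ∈ Submodule.span k (Set.range (hθ.grMonomial n)) :=
    (isHopfModule_gr 𝒜 n).coinvariants_le_span (hθ.grMonomial_mem_grInvariants n)
      (hθ.span_grMonomial h2 n) (grMk_mem_grInvariants 𝒜 ha)
  obtain ⟨c, hc⟩ := (Submodule.mem_span_range_iff_exists_fun k).1 mem_span_grMonomial
  rw [hθ.sum_grMonomial, eq_comm, ← sub_eq_zero, ← map_sub, grMk_eq_zero, AddSubgroupClass.coe_sub,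
    hθ.coe_sum_powMonomial] at hc
  exact ⟨∑ I, c I • monomial θ I, Submodule.sum_mem _ fun I _ =>
    Submodule.smul_mem _ _ (Submodule.subset_span ⟨I, rfl⟩), hc⟩

theorem span_monomial (h2 : (2 : k) ≠ 0) :
    Submodule.span k (Set.range (monomial θ)) = (invariants 𝒜).toSubmodule := by
  have span_le : Submodule.span k (Set.range (monomial θ)) ≤ (invariants 𝒜).toSubmodule :=
    Submodule.span_le.2 (Set.range_subset_iff.2 hθ.monomial_mem_invariants)
  refine le_antisymm span_le fun a ha => ?_
  have exists_sub_mem_pow : ∀ n, ∃ x ∈ Submodule.span k (Set.range (monomial θ)),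
      a - x ∈ superRadical 𝒜 ^ n := fun n => by
    induction n with
    | zero => exact ⟨0, Submodule.zero_mem _, by simp [Submodule.pow_zero]⟩
    | succ n ih =>
      obtain ⟨x, hx, hax⟩ := ih
      obtain ⟨y, hy, hay⟩ := hθ.exists_sub_mem_pow_succ h2
        (Subalgebra.sub_mem _ ha (span_le hx)) hax
      exact ⟨x + y, Submodule.add_mem _ hx hy, by rwa [← sub_sub]⟩
  obtain ⟨N, hN⟩ := exists_superRadical_pow_eq_bot 𝒜 h2
  obtain ⟨x, hx, hax⟩ := exists_sub_mem_pow N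
  rw [hN, Submodule.mem_bot, sub_eq_zero] at hax
  exact hax ▸ hx

theorem finrank_invariants (h2 : (2 : k) ≠ 0) : Module.finrank k (invariants 𝒜) = 2 ^ s := by
  have h := finrank_span_eq_card (hθ.linearIndependent_monomial h2)
  rwa [hθ.span_monomial h2, Fintype.card_finset, Fintype.card_fin] at h

theorem exists_exteriorEquiv (h2 : (2 : k) ≠ 0) :
    ∃ e : ExteriorAlgebra k (Fin s → k) ≃ₐ[k] invariants 𝒜,
      ∀ i, (e (ExteriorAlgebra.ι k (Pi.single i 1)) : A) = θ i := by
  let y (i : Fin s) : invariants 𝒜 := ⟨θ i, hθ.invariant i⟩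
  have hy : IsAnticommuting y :=
    have hanti := isAnticommuting_of_odd 𝒜 h2 hθ.odd
    ⟨fun i => Subtype.ext (hanti.sq i), fun i j => Subtype.ext (hanti.anti i j)⟩
  have val_comp_monomial : (invariants 𝒜).val.toLinearMap ∘ monomial y = monomial θ :=
    funext (map_monomial (invariants 𝒜).val)
  have hli : LinearIndependent k (monomial y) :=
    .of_comp _ (val_comp_monomial ▸ hθ.linearIndependent_monomial h2)
  have hspan : Submodule.span k (Set.range (monomial y)) = ⊤ := by
    apply Submodule.map_injective_of_injective
      (f := (invariants 𝒜).val.toLinearMap) Subtype.val_injective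
    rw [Submodule.map_span, ← Set.range_comp, val_comp_monomial, hθ.span_monomial h2,
      Submodule.map_top]
    exact (Submodule.range_subtype _).symm
  obtain ⟨e, he⟩ := hy.exists_exteriorEquiv hli hspan
  exact ⟨e, fun i => congrArg Subtype.val (he i)⟩

end IsOddCoordinates

end

end SuperHopf

open SuperHopf in
theorem lemma8 {k A : Type*} [Field k] (h2 : (2 : k) ≠ 0) [Ring A] [Algebra k A] [Coalgebra k A]
    (𝒜 : ZMod 2 → Submodule k A) [GradedAlgebra 𝒜] [IsSuperAffineHopfAlgebra 𝒜]
    (s : ℕ) (hs : s = Module.finrank k (lieAlg 𝒜 1)) :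
    Module.Finite k (lieAlg 𝒜 1) ∧
    (∃ θ : Fin s → A, IsOddCoordinates 𝒜 θ) ∧
    (∀ θ : Fin s → A, IsOddCoordinates 𝒜 θ →
      ∃ e : ExteriorAlgebra k (Fin s → k) ≃ₐ[k] invariants 𝒜,
        ∀ i, (e (ExteriorAlgebra.ι k (Pi.single i 1)) : A) = θ i) ∧
    (∀ n : ℕ, Module.Free (evenQuotient 𝒜) (gr 𝒜 n) ∧
      Module.Finite (evenQuotient 𝒜) (gr 𝒜 n) ∧
      Module.finrank (evenQuotient 𝒜) (gr 𝒜 n) = s.choose n) ∧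
    Module.finrank k (invariants 𝒜) = 2 ^ s := by
  obtain ⟨r, θ, hθ⟩ := exists_isOddCoordinates 𝒜 h2
  obtain rfl : s = r := hs.trans (hθ.finrank_lieAlg h2)
  refine ⟨hθ.finite_lieAlg h2, ⟨θ, hθ⟩, fun _ hθ' => hθ'.exists_exteriorEquiv h2, fun n => ?_,
    hθ.finrank_invariants h2⟩
  let b := hθ.grBasis h2 n
  refine ⟨.of_basis b, .of_basis b, ?_⟩
  rw [Module.finrank_eq_card_basis b, Fintype.card_finset_len, Fintype.card_fin]
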